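/- \textbf{Conventions.} Let $q$ be a prime power and let $\mathbb F_{q_0}$ be a subfield of $\mathbb F_q$ with $[\mathbb F_q:\mathbb F_{q_0}]=n\ge 2$. Let $k\ge 2$. A \emph{scattered $\mathbb F_{q_0}$-linear set of rank $t$} in $\mathrm{PG}(2k-1,q)=\mathrm{PG}(W)$ is a point set $S=\{\langle u\rangle_{\mathbb F_q} : u\in U\setminus\{0\}\}$, where $U$ is an $\mathbb F_{q_0}$-subspace of $W$ of dimension $t$ such that $\dim_{\mathbb F_{q_0}}(U\cap P)\le 1$ for every one-dimensional $\mathbb F_q$-subspace $P$ of $W$. Let $S$ be a scattered $\mathbb F_{q_0}$-linear set of rank $kn$ in $\mathrm{PG}(2k-1,q)$. A set $\mathcal R$ of lines of $\mathrm{PG}(2k-1,q)$ is a \emph{pseudoregulus associated with $S$} (and $S$ is then \emph{of pseudoregulus type}) if $\mathcal R$ consists of exactly $\frac{q^k-1}{q-1}$ pairwise disjoint lines, each meeting $S$ in exactly $\frac{q-1}{q_0-1}$ points, and there are exactly two $(k-1)$-dimensional projective subspaces of $\mathrm{PG}(2k-1,q)$ that are disjoint from $S$ and meet every line of $\mathcal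 R$. These two subspaces are called the \emph{transversal spaces} of $\mathcal R$. \textbf{Theorem.} Let $q=2^h$ with $h\ge 4$, let $k\ge 2$, and let $H_\infty=\mathrm{PG}(2k-1,q)$ be a hyperplane of $\mathrm{PG}(2k,q)$. Let $\mathcal Q$ be a set of $q^k$ points of $\mathrm{PG}(2k,q)$, none of them in $H_\infty$, and let $$D=\{P_1P_2\cap H_\infty : P_1,P_2\in\mathcal Q,\ P_1\ne P_2\}$$ be the set of directions determined by $\mathcal Q$. Suppose that $|D|=q^k-1$ and that every line of $H_\infty$ has $0$, $1$, $3$ or $q-1$ points in common with $D$. Then $D$ is a scattered $\mathbb F_2$-linear set of rank $hk$ in $H_\infty$, and the set of all $(q-1)$-secants to $D$ (the lines of $H_\infty$ meeting $D$ in exactly $q-1$ points) is a pseudoregulus associated with $D$. In particular, there are exactly $\frac{q^k-1}{q-1}$ such secants and they are pairwise disjoint. Moreover, the two transversal spaces, that is, the only two $(k-1)$-dimensional subspaces of $H_\infty$ that are disjoint from $D$ and meet every $(q-1)$-secant to $D$, are disjoint from each other. -/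

import Mathlib

open scoped LinearAlgebra.Projectivization

namespace PG

section

variable {F W : Type*} [Field F] [AddCommGroup W] [Module F W]

/-- The set of points of `PG(W)` lying in the projective subspace given by the vector
subspace `L` of `W`. Projective subspaces of dimension `d` are the vector subspaces of
dimension `d + 1`; in particular lines are the vector subspaces of dimension `2`. -/
def points (L : Submodule F W) : Set (ℙ F W) := {P | P.submodule ≤ L}

/-- The set of directions, in the hyperplane at infinity `H`, determined by a set `Q` of points:
all points `P₁P₂ ∩ H` with `P₁ ≠ P₂` in `Q`. -/
def directions (H : Submodule F W) (Q : Set (ℙ F W)) : Set (ℙ F H) :=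
  {P | ∃ P₁ ∈ Q, ∃ P₂ ∈ Q, P₁ ≠ P₂ ∧
    P.submodule.map H.subtype = (P₁.submodule ⊔ P₂.submodule) ⊓ H}

/-- The `n`-secants to a point set `S`: the lines having exactly `n` points in common with `S`. -/
def secants (S : Set (ℙ F W)) (n : ℕ) : Set (Submodule F W) :=
  {L | Module.finrank F L = 2 ∧ (S ∩ points L).ncard = n}

/-- `T` is a `(k - 1)`-dimensional subspace disjoint from `S` and meeting every line of `R`. -/
structure IsTransversal (k : ℕ) (S : Set (ℙ F W)) (R : Set (Submodule F W))
    (T : Submodule F W) : Prop where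
  finrank_eq : Module.finrank F T = k
  disjoint : Disjoint S (points T)
  meets : ∀ s ∈ R, (points T ∩ points s).Nonempty

variable (K : Type*) [Field K] [Algebra K F] [Module K W] [IsScalarTower K F W]

/-- The point set `L_U = {⟨u⟩_F | u ∈ U \ {0}}` defined by a `K`-subspace `U` of the
`F`-vector space `W`. -/
def linearSet (U : Submodule K W) : Set (ℙ F W) :=
  {P | ∃ (u : W) (hu : u ≠ 0), u ∈ U ∧ P = Projectivization.mk F u hu}

/-- `S` is a scattered `K`-linear set of rank `t`: it is `L_U` for a `K`-subspace `U` of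
dimension `t` meeting (the `K`-subspace underlying) each point of `PG(W)` in a `K`-space of
dimension at most one. -/
def IsScatteredLinearSet (t : ℕ) (S : Set (ℙ F W)) : Prop :=
  ∃ U : Submodule K W, Module.finrank K U = t ∧ S = linearSet K U ∧
    ∀ P : ℙ F W, Module.finrank K ↥(U ⊓ P.submodule.restrictScalars K) ≤ 1

/-- The scattered `K`-linear set `S` of `PG(W) = PG(2k - 1, |F|)`, of rank `k [F : K]`, is of
pseudoregulus type, and the set `R` of lines is a pseudoregulus associated with it. -/
structure IsPseudoregulus (k : ℕ) (S : Set (ℙ F W)) (R : Set (Submodule F W)) : Prop where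
  two_le : 2 ≤ k
  two_le_degree : 2 ≤ Module.finrank K F
  finrank_eq : Module.finrank F W = 2 * k
  scattered : IsScatteredLinearSet K (k * Module.finrank K F) S
  lines : ∀ s ∈ R, Module.finrank F s = 2
  ncard_lines : R.ncard = (Nat.card F ^ k - 1) / (Nat.card F - 1)
  pairwise_disjoint : R.PairwiseDisjoint id
  ncard_inter : ∀ s ∈ R, (S ∩ points s).ncard = (Nat.card F - 1) / (Nat.card K - 1)
  transversals : {T | IsTransversal k S R T}.ncard = 2

end

end PG

/-!
In the affine chart of the complement of `H`, with `W` the vector space `H` of dimension `2 * k`,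
the point set is a set `A` of `q ^ k` vectors, and `D` consists of the points `⟨b - a⟩` with `a`,
`b` in `A`.

No three points of `A` are collinear (`PG.eq_or_eq_of_mem_span`), since `|D| = q ^ k - 1`. Hence
every point of `A` sees every direction exactly once, and an affine plane that meets `A` has `1`,
`2`, `4` or `q` points in `A`, depending only on the directions of the plane. Counting in
three-dimensional affine spaces shows that two lines with `q - 1` directions are disjoint
(`PG.false_of_two_secants`). Four points of `A` in a plane on three directions form a
parallelogram. These parallelograms show that `A` is closed under `b + c - a`; in a plane with `q`
points this is seen by a detour through a parallel plane. So the translates of `A` to the origin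
are scattered additive groups `U` of order `q ^ k` (`PG.DirectionGeometry.secantGeometry`).

A scattered group in a space of dimension `n` has order at most `q ^ (n / 2)`
(`PG.Scattered.card_sq_le`). Applied to the image of `U` in the quotient by a point of `D`, this
bound shows that each point of `D` lies on a `(q - 1)`-secant (`PG.SecantGeometry.exists_secant`),
so that these secants partition `D`. Applied to subspaces of `W`, it shows that a secant which
meets the span `X` of two secants `L` and `M` lies in `X`. A secant in `X` other than `L` and `M`
is the graph of a linear map from `L` to `M` that preserves `U`, and there are enough such maps
(`PG.SecantGeometry.exists_hom`).

Consequently the endomorphisms of a secant `L` that preserve `U` form a ring that acts regularly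
on the nonzero vectors of `U` on `L`: a finite division ring, hence a field of order `q`. Its
elements are annihilated by `X ^ q - X`, so they have two common eigenvectors `a` and `b`, which
span the two points of `L` outside `D` (`PG.SecantGeometry.exists_eigenvectors`). The images of
`a` under all linear maps from `L` to `W` that map the vectors of `U` on `L` into `U` form a
transversal space, and the images of `b` form the other one (`PG.SecantGeometry.transversal`). A
third one is impossible, because a transversal space is partitioned by the secants into points
outside `D` (`PG.SecantGeometry.eq_transversal_or_eq_transversal`).
-/

namespace PG

open Module

/-! ### Scattered subgroups and the Blokhuis–Lavrauw bound -/

/-- An additive subgroup `U` of an `F`-vector space is scattered when the points `⟨u⟩` with `u`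
in `U \ {0}` are pairwise distinct, so that every one-dimensional `F`-subspace contains at most
one nonzero vector of `U`. -/
def Scattered (F : Type*) {W : Type*} [Field F] [AddCommGroup W] [Module F W]
    (U : AddSubgroup W) : Prop :=
  ∀ u ∈ U, u ≠ 0 → ∀ c : F, c • u ∈ U → c = 0 ∨ c = 1

section

variable {F W : Type*} [Field F] [AddCommGroup W] [Module F W]

lemma natCard_eq_ker_mul_of_surjective {M N : Type*} [AddCommGroup M] [Module F M]
    [AddCommGroup N] [Module F N] (e : M →ₗ[F] N) (he : Function.Surjective e) :
    Nat.card M = Nat.card N * Nat.card {x // e x = 0} := by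
  rw [Submodule.card_eq_card_quotient_mul_card (LinearMap.ker e), mul_comm,
    Nat.card_congr (e.quotKerEquivOfSurjective he).toEquiv]
  rfl

lemma natCard_dual_eq_mul {u : W} (hu : u ≠ 0) :
    Nat.card (Dual F W) = Nat.card F * Nat.card {f : Dual F W // f u = 0} := by
  refine natCard_eq_ker_mul_of_surjective (Dual.eval F W u) fun c => ?_
  obtain ⟨f, hf⟩ := Module.Projective.exists_dual_ne_zero F hu
  exact ⟨(c / f u) • f, by simp [hf]⟩

lemma natCard_dual_eq_sq_mul {u v : W} (hu : u ∉ Submodule.span F {v})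
    (hv : v ∉ Submodule.span F {u}) :
    Nat.card (Dual F W) =
      Nat.card F ^ 2 * Nat.card {f : Dual F W // f u = 0 ∧ f v = 0} := by
  have h := natCard_eq_ker_mul_of_surjective
    ((Dual.eval F W u).prod (Dual.eval F W v)) fun c => ?_
  · rw [h, Nat.card_prod, sq]
    simp
  · obtain ⟨f, hf, hf'⟩ := Submodule.exists_dual_map_eq_bot_of_notMem hu inferInstance
    obtain ⟨g, hg, hg'⟩ := Submodule.exists_dual_map_eq_bot_of_notMem hv inferInstance
    have hfv : f v = 0 := by
      have := Submodule.mem_map_of_mem (f := f) (Submodule.mem_span_singleton_self (R := F) v)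
      rwa [hf', Submodule.mem_bot] at this
    have hgu : g u = 0 := by
      have := Submodule.mem_map_of_mem (f := g) (Submodule.mem_span_singleton_self (R := F) u)
      rwa [hg', Submodule.mem_bot] at this
    exact ⟨(c.1 / f u) • f + (c.2 / g v) • g, by ext <;> simp [hf, hg, hfv, hgu]⟩

lemma Scattered.eq_zero_or_eq {U : AddSubgroup W} (hU : Scattered F U) {u v : W} (hu : u ∈ U)
    (hu0 : u ≠ 0) (hv : v ∈ U) (h : v ∈ Submodule.span F {u}) : v = 0 ∨ v = u := by
  obtain ⟨c, rfl⟩ := Submodule.mem_span_singleton.1 h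
  rcases hU u hu hu0 c hv with rfl | rfl <;> simp

/-- The values `q * x - M` and `q * x - 2 * M` have the same sign, `x` being the number of
vectors of `U` in the kernel of `f` and `M` the order of `U`: the quotient `M / x` is the order
of `f(U)`, a subgroup of `F`, hence `q` or at most `q / 2`. -/
lemma mul_sub_mul_sub_nonneg [Finite F] (U : AddSubgroup W) (f : Dual F W) :
    0 ≤ ((Nat.card F : ℤ) * Nat.card {u : U // f u = 0} - Nat.card U) *
      ((Nat.card F : ℤ) * Nat.card {u : U // f u = 0} - 2 * Nat.card U) := by
  set g : U →+ F := f.toAddMonoidHom.comp U.subtype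
  have h1 : Nat.card {u : U // f u = 0} * Nat.card g.range = Nat.card U := by
    rw [← AddSubgroup.card_mul_index g.ker, AddSubgroup.index_ker]
    rfl
  obtain ⟨z, hz⟩ := g.range.card_addSubgroup_dvd_card
  have hz0 : z ≠ 0 := by
    rintro rfl
    exact Nat.card_pos.ne' hz
  rw [← h1, hz]
  push_cast
  set x : ℤ := (Nat.card {u : U // f u = 0} : ℤ)
  set y : ℤ := (Nat.card g.range : ℤ)
  have : (y * z * x - x * y) * (y * z * x - 2 * (x * y)) =
    (x * y) ^ 2 * (((z : ℤ) - 1) * (z - 2)) := by ring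
  rw [this]
  refine mul_nonneg (sq_nonneg _) ?_
  obtain h | h : z = 1 ∨ 2 ≤ z := by omega
  · simp [h]
  · have : (2 : ℤ) ≤ z := by exact_mod_cast h
    exact mul_nonneg (by linarith) (by linarith)

/-- The Blokhuis–Lavrauw bound for scattered subgroups: the sum over all linear forms of the
nonnegative products of `mul_sub_mul_sub_nonneg` is determined by `U` being scattered, and the zero
form alone contributes `M² (q - 1) (q - 2)` to it. -/
theorem Scattered.card_sq_le [Finite F] [FiniteDimensional F W] {U : AddSubgroup W}
    (hU : Scattered F U) (hF : 2 < Nat.card F) :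
    Nat.card U ^ 2 ≤ Nat.card F ^ finrank F W := by
  classical
  have : Finite W := Module.finite_of_finite F
  have : Finite (Dual F W) := Module.finite_of_finite F
  have : Fintype (Dual F W) := Fintype.ofFinite _
  have : Fintype U := Fintype.ofFinite _
  set q : ℤ := (Nat.card F : ℤ) with hq
  set M : ℤ := (Nat.card U : ℤ) with hM
  set N : ℤ := (Nat.card (Dual F W) : ℤ) with hN
  have hN' : N = q ^ finrank F W := by
    rw [hN, Module.natCard_eq_pow_finrank (K := F), Subspace.dual_finrank_eq]
    push_cast
    rfl
  have hMc : M = ∑ _u : U, 1 := by simp [hM]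
  have hNc : N = ∑ _f : Dual F W, 1 := by simp [hN]
  set x : Dual F W → ℤ := fun f => Nat.card {u : U // f u = 0} with hx
  have hx1 : ∀ f, x f = ∑ u : U, if f u = 0 then 1 else 0 := by
    intro f
    simp [hx, Nat.card_eq_fintype_card, Fintype.card_subtype]
  -- the number of forms vanishing at `u`, multiplied by `q`
  have e1 : ∀ u : U, q * (∑ f : Dual F W, if f u = 0 then 1 else 0) =
      N + if u = 0 then (q - 1) * N else 0 := by
    intro u
    by_cases hu : u = 0
    · subst hu
      simp [hN]
      ring
    · have := natCard_dual_eq_mul (F := F) (u := (u : W)) (by simpa using hu)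
      simp only [hu, if_false, add_zero, hN, this]
      simp [Nat.card_eq_fintype_card, Fintype.card_subtype, hq]
  -- the number of forms vanishing at `u` and at `v`, multiplied by `q²`
  have e2 : ∀ u v : U, q ^ 2 * (∑ f : Dual F W, if f u = 0 ∧ f v = 0 then 1 else 0) =
      if u = 0 then (q * N + if v = 0 then q * (q - 1) * N else 0)
      else (N + (if v = 0 then (q - 1) * N else 0) + if v = u then (q - 1) * N else 0) := by
    intro u v
    by_cases hu : u = 0
    · subst hu
      have := e1 v
      simp only [ZeroMemClass.coe_zero, map_zero, true_and, if_true]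
      rw [sq, mul_assoc, this]
      split_ifs <;> ring
    · have h1 := e1 u
      simp only [hu, if_false, add_zero] at h1 ⊢
      by_cases hv : v = 0
      · subst hv
        simp only [ZeroMemClass.coe_zero, map_zero, and_true, if_true, Ne.symm hu, if_false]
        rw [sq, mul_assoc, h1]
        ring
      · by_cases hvu : v = u
        · subst hvu
          simp only [and_self, hv, if_false, if_true]
          rw [sq, mul_assoc, h1]
          ring
        · have hu' : (u : W) ≠ 0 := by simpa using hu
          have hv' : (v : W) ≠ 0 := by simpa using hv
          have := natCard_dual_eq_sq_mul (F := F) (u := (u : W)) (v := (v : W))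
            (fun h => by
              rcases hU.eq_zero_or_eq v.2 hv' u.2 h with h | h
              · exact hu' h
              · exact hvu (Subtype.ext h.symm))
            (fun h => by
              rcases hU.eq_zero_or_eq u.2 hu' v.2 h with h | h
              · exact hv' h
              · exact hvu (Subtype.ext h))
          simp only [hv, hvu, if_false, add_zero, hN, this]
          simp [Nat.card_eq_fintype_card, Fintype.card_subtype, hq]
  have s1 : q * ∑ f, x f = M * N + (q - 1) * N := by
    simp only [hx1]
    rw [Finset.sum_comm, Finset.mul_sum, Finset.sum_congr rfl fun u _ => e1 u,
      Finset.sum_add_distrib]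
    simp [hM]
  have s2 : q ^ 2 * ∑ f, x f ^ 2 =
      M * (q * N) + q * (q - 1) * N + (M - 1) * (M * N + 2 * ((q - 1) * N)) := by
    have hxx : ∀ f, x f ^ 2 = ∑ u : U, ∑ v : U, if f u = 0 ∧ f v = 0 then 1 else 0 := by
      intro f
      rw [hx1, sq, Finset.sum_mul_sum]
      refine Finset.sum_congr rfl fun u _ => Finset.sum_congr rfl fun v _ => ?_
      by_cases h1 : f u = 0 <;> by_cases h2 : f v = 0 <;> simp [h1, h2]
    have inner : ∀ u : U, q ^ 2 * (∑ v : U, ∑ f : Dual F W, if f u = 0 ∧ f v = 0 then 1 else 0) =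
        (M * N + 2 * ((q - 1) * N)) +
          if u = 0 then (M * (q * N) + q * (q - 1) * N) - (M * N + 2 * ((q - 1) * N)) else 0 := by
      intro u
      rw [Finset.mul_sum, Finset.sum_congr rfl fun v _ => e2 u v]
      by_cases hu : u = 0
      · simp [hu, Finset.sum_add_distrib, hM]
      · simp [hu, Finset.sum_add_distrib, hM]
        ring
    rw [Finset.sum_congr rfl fun f _ => hxx f, Finset.sum_comm]
    rw [Finset.sum_congr rfl fun u _ => Finset.sum_comm, Finset.mul_sum,
      Finset.sum_congr rfl fun u _ => inner u, Finset.sum_add_distrib]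
    simp only [Finset.sum_const, Finset.sum_ite_eq', Finset.mem_univ, if_true, Finset.card_univ,
      nsmul_eq_mul, ← Nat.card_eq_fintype_card, ← hM]
    ring
  have s3 : ∑ f, (q * x f - M) * (q * x f - 2 * M) = N * ((q - 1) * (q - 2)) := by
    have : ∀ f, (q * x f - M) * (q * x f - 2 * M) =
        q ^ 2 * x f ^ 2 - 3 * M * (q * x f) + 2 * M ^ 2 * 1 := fun f => by ring
    rw [Finset.sum_congr rfl fun f _ => this f, Finset.sum_add_distrib, Finset.sum_sub_distrib,
      ← Finset.mul_sum, ← Finset.mul_sum, ← Finset.mul_sum, ← Finset.mul_sum, ← hNc, s1, s2]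
    ring
  have s4 : M ^ 2 * ((q - 1) * (q - 2)) ≤ N * ((q - 1) * (q - 2)) := by
    rw [← s3]
    have h0 : x 0 = M := by simp [hx, hM]
    calc M ^ 2 * ((q - 1) * (q - 2)) = (q * x 0 - M) * (q * x 0 - 2 * M) := by rw [h0]; ring
      _ ≤ _ := Finset.single_le_sum (f := fun f => (q * x f - M) * (q * x f - 2 * M))
        (fun f _ => mul_sub_mul_sub_nonneg U f) (Finset.mem_univ 0)
  have hq3 : (2 : ℤ) < q := by rw [hq]; exact_mod_cast hF
  have := le_of_mul_le_mul_right s4 (mul_pos (by linarith) (by linarith))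
  rw [hN', hM, hq] at this
  exact_mod_cast this

end

/-! ### Secants of a scattered subgroup of maximum order -/

section

variable {F W : Type*} [Field F] [AddCommGroup W] [Module F W]

lemma card_inf_mul_relIndex {A : Type*} [AddCommGroup A] (G H : AddSubgroup A) :
    Nat.card ↥(G ⊓ H) * H.relIndex G = Nat.card G := by
  rw [← AddSubgroup.relIndex_bot_left (G ⊓ H), ← AddSubgroup.relIndex_bot_left G,
    ← AddSubgroup.inf_relIndex_right H G, inf_comm H G,
    AddSubgroup.relIndex_mul_relIndex _ _ _ bot_le inf_le_left]

lemma card_inf_ker_mul_card_map {A B : Type*} [AddCommGroup A] [AddCommGroup B] (f : A →+ B)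
    (G : AddSubgroup A) : Nat.card ↥(G ⊓ f.ker) * Nat.card ↥(G.map f) = Nat.card G := by
  rw [← AddSubgroup.relIndex_ker, card_inf_mul_relIndex]

lemma card_sup_mul_card_inf {A : Type*} [AddCommGroup A] (G H : AddSubgroup A) :
    Nat.card ↥(G ⊔ H) * Nat.card ↥(G ⊓ H) = Nat.card G * Nat.card H := by
  rw [← card_inf_mul_relIndex (G ⊔ H) H, inf_eq_right.2 (le_sup_right : H ≤ G ⊔ H),
    AddSubgroup.relIndex_sup_right, ← card_inf_mul_relIndex G H]
  ring

/-- The vectors of `U` in the subspace `Y`. -/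
abbrev sect (U : AddSubgroup W) (Y : Submodule F W) : AddSubgroup W := U ⊓ Y.toAddSubgroup

lemma card_comap_subtype (U : AddSubgroup W) (Y : Submodule F W) :
    Nat.card (U.comap Y.subtype.toAddMonoidHom) = Nat.card (sect U Y) :=
  Nat.card_congr
    { toFun := fun x => ⟨x.1, x.2, x.1.2⟩
      invFun := fun x => ⟨⟨x, x.2.2⟩, x.2.1⟩
      left_inv := fun _ => rfl
      right_inv := fun _ => rfl }

lemma Scattered.card_sect_sq_le [Finite F] [FiniteDimensional F W] {U : AddSubgroup W}
    (hU : Scattered F U) (hF : 2 < Nat.card F) (Y : Submodule F W) :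
    Nat.card (sect U Y) ^ 2 ≤ Nat.card F ^ finrank F Y := by
  have h : Scattered F (U.comap Y.subtype.toAddMonoidHom) := by
    intro u hu hu0 c hc
    exact hU u hu (by simpa using hu0) c hc
  rw [← card_comap_subtype]
  exact h.card_sq_le hF

lemma Scattered.card_sect_le_two {U : AddSubgroup W} (hU : Scattered F U) {P : Submodule F W}
    [FiniteDimensional F P] (hP : finrank F P ≤ 1) : Nat.card (sect U P) ≤ 2 := by
  obtain ⟨v, hv⟩ := finrank_le_one_iff.1 hP
  by_cases h : ∃ u ∈ sect U P, u ≠ 0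
  · obtain ⟨u, hu, hu0⟩ := h
    have key : ∀ x ∈ sect U P, x = 0 ∨ x = u := by
      intro x hx
      refine hU.eq_zero_or_eq hu.1 hu0 hx.1 ?_
      obtain ⟨a, ha⟩ := hv ⟨u, hu.2⟩
      obtain ⟨b, hb⟩ := hv ⟨x, hx.2⟩
      have ha' : a • (v : W) = u := congrArg Subtype.val ha
      have hb' : b • (v : W) = x := congrArg Subtype.val hb
      have ha0 : a ≠ 0 := by
        rintro rfl
        exact hu0 (by rw [← ha', zero_smul])
      refine Submodule.mem_span_singleton.2 ⟨b / a, ?_⟩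
      rw [← ha', ← hb', smul_smul, div_mul_cancel₀ _ ha0]
    have : (sect U P : Set W) ⊆ ({0, u} : Set W) := fun x hx => key x hx
    calc Nat.card (sect U P) = (sect U P : Set W).ncard := rfl
      _ ≤ ({0, u} : Set W).ncard := Set.ncard_le_ncard this
      _ ≤ ({u} : Set W).ncard + 1 := Set.ncard_insert_le _ _
      _ = 2 := by simp
  · have h0 : sect U P = ⊥ := by
      rw [AddSubgroup.eq_bot_iff_forall]
      intro x hx
      by_contra hx0
      exact h ⟨x, hx, hx0⟩
    rw [h0]
    simp

/-- A secant of `U`: a line containing as many vectors of `U` as `F` has elements. -/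
def IsSecant (U : AddSubgroup W) (L : Submodule F W) : Prop :=
  finrank F L = 2 ∧ Nat.card (sect U L) = Nat.card F

variable (F) in
/-- The properties, established for the translates to the origin of the affine set in question,
from which the pseudoregulus is constructed: `U` is a scattered subgroup of order `q ^ k` in a space
of dimension `2 * k`, a line carries at most four vectors of `U` unless it is a secant, and distinct
secants are disjoint. -/
structure SecantGeometry (k : ℕ) (U : AddSubgroup W) : Prop where
  two_le : 2 ≤ k
  le_card : 16 ≤ Nat.card F
  finrank_eq : finrank F W = 2 * k
  card_eq : Nat.card U = Nat.card F ^ k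
  scattered : Scattered F U
  card_sect : ∀ L : Submodule F W, finrank F L = 2 →
    Nat.card (sect U L) ≤ 4 ∨ Nat.card (sect U L) = Nat.card F
  disjoint : ∀ L L' : Submodule F W, IsSecant U L → IsSecant U L' → L ≠ L' → Disjoint L L'

lemma finrank_span_pair_eq_two {u v : W} (hu : u ≠ 0) (hv : v ∉ Submodule.span F {u}) :
    finrank F (Submodule.span F {u, v}) = 2 := by
  have h : LinearIndependent F ![u, v] := by
    rw [LinearIndependent.pair_iff' hu]
    intro a ha
    exact hv (Submodule.mem_span_singleton.2 ⟨a, ha⟩)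
  have := finrank_span_eq_card h
  rwa [Matrix.range_cons_cons_empty] at this

lemma span_pair_eq_of_mem {p x : W} {L : Submodule F W} (hL : finrank F L = 2) (hp0 : p ≠ 0)
    (hx : x ∉ Submodule.span F {p}) (hpL : p ∈ L) (hxL : x ∈ L) :
    Submodule.span F {p, x} = L := by
  have : FiniteDimensional F L := Module.finite_of_finrank_pos (by omega)
  refine Submodule.eq_of_le_of_finrank_eq ?_ ((finrank_span_pair_eq_two hp0 hx).trans hL.symm)
  rw [Submodule.span_le, Set.insert_subset_iff, Set.singleton_subset_iff]
  exact ⟨hpL, hxL⟩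

namespace SecantGeometry

variable {k : ℕ} {U : AddSubgroup W}

lemma finite (G : SecantGeometry F k U) : Finite F :=
  Nat.finite_of_card_ne_zero (by have := G.le_card; omega)

lemma finiteDimensional (G : SecantGeometry F k U) : FiniteDimensional F W :=
  Module.finite_of_finrank_pos (by rw [G.finrank_eq]; have := G.two_le; omega)

lemma finite_space (G : SecantGeometry F k U) : Finite W := by
  have := G.finite
  have := G.finiteDimensional
  exact Module.finite_of_finite F

lemma eq_of_mem (G : SecantGeometry F k U) {L L' : Submodule F W} (hL : IsSecant U L)
    (hL' : IsSecant U L') {z : W} (hz : z ≠ 0) (h : z ∈ L) (h' : z ∈ L') : L = L' := by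
  by_contra hne
  exact hz (Submodule.disjoint_def.1 (G.disjoint L L' hL hL' hne) z h h')

/-- If no secant passed through `u`, then the image of `U` in the quotient by `⟨u⟩` would still be
scattered, and of order `q ^ k / 2`, which contradicts the Blokhuis–Lavrauw bound. -/
lemma exists_secant (G : SecantGeometry F k U) {u : W} (hu : u ∈ U) (hu0 : u ≠ 0) :
    ∃ L : Submodule F W, IsSecant U L ∧ u ∈ L := by
  classical
  have := G.finite
  have := G.finite_space
  by_contra hno
  push Not at hno
  set P := Submodule.span F {u} with hP
  have hscat : Scattered F (U.map P.mkQ.toAddMonoidHom) := by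
    rintro _ ⟨v, hv, rfl⟩ hv0 c ⟨w, hw, hwc⟩
    have hv0' : v ∉ P := by
      simpa [P.mkQ_apply, Submodule.Quotient.mk_eq_zero] using hv0
    have hwc' : w - c • v ∈ P := by
      rw [← Submodule.Quotient.mk_eq_zero, Submodule.Quotient.mk_sub, sub_eq_zero]
      exact hwc
    have hL2 := finrank_span_pair_eq_two (F := F) hu0 hv0'
    set L := Submodule.span F {u, v} with hL
    have huL : u ∈ L := Submodule.subset_span (by simp)
    have hvL : v ∈ L := Submodule.subset_span (by simp)
    have hPL : P ≤ L := by rw [hP, Submodule.span_singleton_le_iff_mem]; exact huL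
    have hwL : w ∈ L := by
      have := L.add_mem (hPL hwc') (L.smul_mem c hvL)
      simpa using this
    have hcard : Nat.card (sect U L) ≤ 4 := by
      rcases G.card_sect L hL2 with h | h
      · exact h
      · exact absurd huL (hno L ⟨hL2, h⟩)
    have huP : u ∈ P := Submodule.mem_span_singleton_self u
    have hsub : ({0, u, v, u + v} : Finset W) ⊆ (Set.toFinite (sect U L : Set W)).toFinset := by
      intro x hx
      simp only [Finset.mem_insert, Finset.mem_singleton] at hx
      rw [Set.Finite.mem_toFinset]
      rcases hx with rfl | rfl | rfl | rfl
      · exact zero_mem (sect U L)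
      · exact ⟨hu, huL⟩
      · exact ⟨hv, hvL⟩
      · exact ⟨U.add_mem hu hv, L.add_mem huL hvL⟩
    have h4 : ({0, u, v, u + v} : Finset W).card = 4 := by
      have h1 : v ≠ 0 := fun h => hv0' (h ▸ P.zero_mem)
      have h2 : u ≠ v := fun h => hv0' (h ▸ huP)
      have h3 : u + v ≠ 0 := fun h => hv0' (by
        rw [eq_neg_of_add_eq_zero_right h]; exact P.neg_mem huP)
      rw [Finset.card_eq_succ]
      refine ⟨0, {u, v, u + v}, ?_, rfl, ?_⟩
      · simp [Ne.symm hu0, Ne.symm h1, Ne.symm h3]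
      · rw [Finset.card_eq_three]
        exact ⟨u, v, u + v, h2, by simpa using h1, by simpa using hu0, rfl⟩
    have heq := Finset.eq_of_subset_of_card_le hsub (by
      rw [h4, ← Set.ncard_eq_toFinset_card]
      exact hcard)
    have hw4 : w ∈ ({0, u, v, u + v} : Finset W) := by
      rw [heq, Set.Finite.mem_toFinset]
      exact ⟨hw, hwL⟩
    simp only [Finset.mem_insert, Finset.mem_singleton] at hw4
    have hcase : w ∈ P ∨ w - v ∈ P := by
      rcases hw4 with rfl | rfl | rfl | rfl
      · exact Or.inl P.zero_mem
      · exact Or.inl huP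
      · exact Or.inr (by simp)
      · exact Or.inr (by simpa using huP)
    rcases hcase with h | h
    · left
      by_contra hc
      refine hv0' ?_
      have := P.sub_mem h hwc'
      rw [sub_sub_cancel] at this
      exact (P.smul_mem_iff hc).1 this
    · right
      by_contra hc
      refine hv0' ?_
      have := P.sub_mem h hwc'
      rw [sub_sub_sub_cancel_left, show c • v - v = (c - 1) • v by rw [sub_smul, one_smul]] at this
      exact (P.smul_mem_iff (sub_ne_zero.2 hc)).1 this
  have hle := hscat.card_sq_le (F := F) (by have := G.le_card; omega)
  have hP1 : finrank F P = 1 := finrank_span_singleton hu0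
  have hdim : finrank F (W ⧸ P) + 1 = 2 * k := by
    rw [← hP1, P.finrank_quotient_add_finrank, G.finrank_eq]
  have hcard := card_inf_ker_mul_card_map P.mkQ.toAddMonoidHom U
  have hker : Nat.card ↥(U ⊓ P.mkQ.toAddMonoidHom.ker) ≤ 2 := by
    have h : U ⊓ P.mkQ.toAddMonoidHom.ker = sect U P := by
      ext x
      simp [AddMonoidHom.mem_ker]
    rw [h]
    exact G.scattered.card_sect_le_two hP1.le
  rw [G.card_eq] at hcard
  set m := Nat.card ↥(U.map P.mkQ.toAddMonoidHom)
  set q := Nat.card F with hq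
  have h1 : q ^ k ≤ 2 * m := hcard ▸ Nat.mul_le_mul_right m hker
  have h2 : q ^ (2 * k) ≤ 4 * m ^ 2 := by
    calc q ^ (2 * k) = (q ^ k) ^ 2 := by rw [← pow_mul, mul_comm]
      _ ≤ (2 * m) ^ 2 := Nat.pow_le_pow_left h1 2
      _ = 4 * m ^ 2 := by ring
  rw [← hdim, pow_succ] at h2
  have h3 : q ^ finrank F (W ⧸ P) * q ≤ q ^ finrank F (W ⧸ P) * 4 := by linarith
  have h4 := Nat.le_of_mul_le_mul_left h3 (pow_pos (by have := G.le_card; omega) _)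
  have := G.le_card
  omega

/-- A subspace `S` that attains the Blokhuis–Lavrauw bound absorbs every secant it meets:
otherwise the span of both would violate the bound. -/
lemma secant_le (G : SecantGeometry F k U) {S L : Submodule F W}
    (hS : Nat.card F ^ finrank F S ≤ Nat.card (sect U S) ^ 2) (hL : IsSecant U L)
    (hLS : ¬ Disjoint S L) : L ≤ S := by
  have := G.finite
  have := G.finite_space
  by_contra hle
  have h0 : finrank F ↥(S ⊓ L) ≠ 0 := by
    rw [Ne, Submodule.finrank_eq_zero]
    exact fun h => hLS (disjoint_iff.2 h)
  have h1 : finrank F ↥(S ⊓ L) < finrank F L :=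
    Submodule.finrank_lt_finrank_of_lt (lt_of_le_of_ne inf_le_right fun h => hle (inf_eq_right.1 h))
  have h2 := Submodule.finrank_sup_add_finrank_inf_eq S L
  rw [hL.1] at h1 h2
  have h3 : finrank F ↥(S ⊓ L) = 1 := by omega
  have h4 : finrank F ↥(S ⊔ L) = finrank F S + 1 := by omega
  have h5 := card_sup_mul_card_inf (sect U S) (sect U L)
  have h6 : sect U S ⊓ sect U L = sect U (S ⊓ L) := by
    ext x
    simp only [AddSubgroup.mem_inf, Submodule.mem_toAddSubgroup, Submodule.mem_inf]
    tauto
  have h7 : sect U S ⊔ sect U L ≤ sect U (S ⊔ L) :=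
    sup_le (fun x hx => ⟨hx.1, Submodule.mem_sup_left hx.2⟩)
      (fun x hx => ⟨hx.1, Submodule.mem_sup_right hx.2⟩)
  have h8 : Nat.card ↥(sect U S ⊔ sect U L) ≤ Nat.card (sect U (S ⊔ L)) :=
    AddSubgroup.card_le_of_le h7
  have h9 := G.scattered.card_sect_sq_le (F := F) (by have := G.le_card; omega) (S ⊔ L)
  have h10 := G.scattered.card_sect_le_two h3.le
  rw [h6, hL.2] at h5
  rw [h4, pow_succ] at h9
  set q := Nat.card F
  set s := Nat.card (sect U S)
  set m := Nat.card (sect U (S ⊔ L))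
  have h11 : s * q ≤ m * 2 := by
    rw [← h5]
    exact Nat.mul_le_mul h8 h10
  have h12 : q ^ finrank F S * q ^ 2 ≤ q ^ finrank F S * q * 4 := by
    calc q ^ finrank F S * q ^ 2 ≤ s ^ 2 * q ^ 2 := Nat.mul_le_mul_right _ hS
      _ = (s * q) ^ 2 := by ring
      _ ≤ (m * 2) ^ 2 := Nat.pow_le_pow_left h11 2
      _ = m ^ 2 * 4 := by ring
      _ ≤ _ := Nat.mul_le_mul_right _ h9
  have hq := G.le_card
  have hqpos : 0 < q := by omega
  have h13 : (q ^ finrank F S * q) * q ≤ (q ^ finrank F S * q) * 4 := by linarith [h12, sq q]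
  have := Nat.le_of_mul_le_mul_left h13 (by positivity)
  omega

lemma finrank_sup_secants (G : SecantGeometry F k U) {L M : Submodule F W} (hL : IsSecant U L)
    (hM : IsSecant U M) (hLM : L ≠ M) : finrank F ↥(L ⊔ M) = 4 := by
  have := G.finiteDimensional
  have h := Submodule.finrank_sup_add_finrank_inf_eq L M
  rw [(G.disjoint L M hL hM hLM).eq_bot, finrank_bot, hL.1, hM.1] at h
  omega

lemma card_sup_sect (G : SecantGeometry F k U) {L M : Submodule F W} (hL : IsSecant U L)
    (hM : IsSecant U M) (hLM : L ≠ M) :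
    Nat.card ↥(sect U L ⊔ sect U M) = Nat.card F ^ 2 := by
  have h5 := card_sup_mul_card_inf (sect U L) (sect U M)
  have h6 : sect U L ⊓ sect U M = ⊥ := by
    rw [AddSubgroup.eq_bot_iff_forall]
    intro x hx
    exact Submodule.disjoint_def.1 (G.disjoint L M hL hM hLM) x hx.1.2 hx.2.2
  rw [h6, hL.2, hM.2, AddSubgroup.card_bot, mul_one] at h5
  rw [h5, sq]

lemma sect_sup_secants (G : SecantGeometry F k U) {L M : Submodule F W} (hL : IsSecant U L)
    (hM : IsSecant U M) (hLM : L ≠ M) : sect U (L ⊔ M) = sect U L ⊔ sect U M := by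
  have := G.finite
  have := G.finite_space
  symm
  refine AddSubgroup.eq_of_le_of_card_ge
    (sup_le (fun x hx => ⟨hx.1, Submodule.mem_sup_left hx.2⟩)
      (fun x hx => ⟨hx.1, Submodule.mem_sup_right hx.2⟩)) ?_
  rw [G.card_sup_sect hL hM hLM]
  have h9 := G.scattered.card_sect_sq_le (F := F) (by have := G.le_card; omega) (L ⊔ M)
  rw [G.finrank_sup_secants hL hM hLM] at h9
  refine (Nat.pow_le_pow_iff_left two_ne_zero).1 (h9.trans_eq ?_)
  ring

end SecantGeometry

end

/-! ### Linear maps between secants -/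

section

variable {F W : Type*} [Field F] [AddCommGroup W] [Module F W]

/-- The additive group of the `F`-linear maps from `L` to the whole space that map the vectors of
`U` on `L` into `U`. -/
def homs (U : AddSubgroup W) (L : Submodule F W) : AddSubgroup (L →ₗ[F] W) where
  carrier := {g | ∀ x : L, (x : W) ∈ U → g x ∈ U}
  add_mem' hg hg' x hx := U.add_mem (hg x hx) (hg' x hx)
  zero_mem' _ _ := U.zero_mem
  neg_mem' hg x hx := U.neg_mem (hg x hx)

/-- The ring of the `F`-linear endomorphisms of `L` that preserve the set of vectors of `U`
on `L`. -/
def stab (U : AddSubgroup W) (L : Submodule F W) : Subring (End F L) where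
  carrier := {g | ∀ x : L, (x : W) ∈ U → (g x : W) ∈ U}
  add_mem' hg hg' x hx := U.add_mem (hg x hx) (hg' x hx)
  zero_mem' _ _ := U.zero_mem
  neg_mem' hg x hx := U.neg_mem (hg x hx)
  one_mem' _ hx := hx
  mul_mem' hg hg' x hx := hg _ (hg' x hx)

lemma comp_mem_homs {U : AddSubgroup W} {L : Submodule F W} {g : L →ₗ[F] W} (hg : g ∈ homs U L)
    {e : End F L} (he : e ∈ stab U L) : g ∘ₗ e ∈ homs U L :=
  fun x hx => hg _ (he x hx)

lemma subtype_comp_mem_homs {U : AddSubgroup W} {L : Submodule F W} {e : End F L}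
    (he : e ∈ stab U L) : L.subtype ∘ₗ e ∈ homs U L :=
  fun x hx => he x hx

namespace SecantGeometry

variable {k : ℕ} {U : AddSubgroup W}

lemma exists_mem_sect_notMem (G : SecantGeometry F k U) {L P : Submodule F W}
    (hL : IsSecant U L) (hP : finrank F P ≤ 1) : ∃ u ∈ sect U L, u ∉ P := by
  have := G.finite_space
  by_contra h
  push Not at h
  have h1 : sect U L ≤ sect U P := fun x hx => ⟨hx.1, h x hx⟩
  have h2 := AddSubgroup.card_le_of_le h1
  rw [hL.2] at h2
  have h3 := G.scattered.card_sect_le_two hP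
  have := G.le_card
  omega

lemma exists_mem_sect_ne_zero (G : SecantGeometry F k U) {L : Submodule F W}
    (hL : IsSecant U L) : ∃ u ∈ sect U L, u ≠ 0 := by
  obtain ⟨u, hu, hu'⟩ := G.exists_mem_sect_notMem hL (P := ⊥) (by simp)
  exact ⟨u, hu, by simpa using hu'⟩

lemma exists_secant_ne (G : SecantGeometry F k U) {L : Submodule F W} (hL : IsSecant U L) :
    ∃ M : Submodule F W, IsSecant U M ∧ M ≠ L := by
  have := G.finite_space
  have hex : ∃ u ∈ U, u ∉ L := by
    by_contra h
    push Not at h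
    have h1 : U ≤ sect U L := fun x hx => ⟨hx, h x hx⟩
    have h2 := AddSubgroup.card_le_of_le h1
    rw [hL.2, G.card_eq] at h2
    have hq := G.le_card
    have h3 : Nat.card F ^ 1 < Nat.card F ^ k :=
      Nat.pow_lt_pow_right (by omega) (by have := G.two_le; omega)
    rw [pow_one] at h3
    omega
  obtain ⟨u, hu, huL⟩ := hex
  obtain ⟨M, hM, huM⟩ := G.exists_secant hu (fun h => huL (h ▸ L.zero_mem))
  exact ⟨M, hM, fun h => huL (h ▸ huM)⟩

/-- The secant through `w + u` lies in the span of `L` and `M`, where it is the graph of a linear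
map from `L` to `M`; this map sends `w` to `u` and preserves `U`. -/
lemma exists_hom (G : SecantGeometry F k U) {L M : Submodule F W} (hL : IsSecant U L)
    (hM : IsSecant U M) (hLM : L ≠ M) {w u : W} (hw : w ∈ sect U L) (hw0 : w ≠ 0)
    (hu : u ∈ sect U M) (hu0 : u ≠ 0) :
    ∃ g : L →ₗ[F] W, (∀ x, g x ∈ M) ∧ g ∈ homs U L ∧ g ⟨w, hw.2⟩ = u := by
  have := G.finite_space
  have hdisj := G.disjoint L M hL hM hLM
  have hwM : w ∉ M := fun h => hw0 (Submodule.disjoint_def.1 hdisj w hw.2 h)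
  have huL : u ∉ L := fun h => hu0 (Submodule.disjoint_def.1 hdisj u h hu.2)
  have hwu0 : w + u ≠ 0 := fun h => hwM (by
    rw [eq_neg_of_add_eq_zero_left h]
    exact M.neg_mem hu.2)
  obtain ⟨N, hN, hwuN⟩ := G.exists_secant (U.add_mem hw.1 hu.1) hwu0
  have hNM : N ≠ M := fun h => hwM (by
    have := M.sub_mem (h ▸ hwuN) hu.2
    simpa using this)
  have hNLM : N ≤ L ⊔ M := by
    refine G.secant_le ?_ hN fun h => hwu0 ?_
    · rw [G.finrank_sup_secants hL hM hLM, G.sect_sup_secants hL hM hLM,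
        G.card_sup_sect hL hM hLM, ← pow_mul]
    · exact Submodule.disjoint_def.1 h _
        (add_mem (Submodule.mem_sup_left hw.2) (Submodule.mem_sup_right hu.2)) hwuN
  obtain ⟨M', hMM', hc⟩ := hdisj.symm.exists_isCompl
  set P := L.projectionOnto M' hc.symm with hP
  have hPadd : ∀ l (hl : l ∈ L), ∀ m ∈ M, P (l + m) = ⟨l, hl⟩ := by
    intro l hl m hm
    rw [map_add, hP, Submodule.projectionOnto_apply_of_mem_left hc.symm hl,
      (Submodule.projectionOnto_apply_eq_zero_iff hc.symm).2 (hMM' hm), add_zero]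
  have hPM : ∀ z ∈ N, z - P z ∈ M := by
    intro z hz
    obtain ⟨l, hl, m, hm, rfl⟩ := Submodule.mem_sup.1 (hNLM hz)
    rw [hPadd l hl m hm]
    simpa using hm
  set p : N →ₗ[F] L := P ∘ₗ N.subtype with hp
  have hpinj : Function.Injective p := by
    rw [injective_iff_map_eq_zero]
    intro z hz
    have h1 := hPM z z.2
    have h2 : P z = 0 := hz
    rw [h2, ZeroMemClass.coe_zero, sub_zero] at h1
    by_contra hz0
    exact hNM (G.eq_of_mem hN hM (z := (z : W)) (by simpa using hz0) z.2 h1)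
  set e : N ≃ₗ[F] L := LinearEquiv.ofInjectiveOfFinrankEq p hpinj (by rw [hN.1, hL.1]) with he
  have hep : ∀ z, e z = p z := fun z => rfl
  have hpsect : ∀ z : N, (z : W) ∈ U → (p z : W) ∈ U := by
    intro z hz
    have h1 : (z : W) ∈ sect U (L ⊔ M) := ⟨hz, hNLM z.2⟩
    rw [G.sect_sup_secants hL hM hLM] at h1
    obtain ⟨l, hl, m, hm, hlm⟩ := AddSubgroup.mem_sup.1 h1
    have : p z = ⟨l, hl.2⟩ := by
      rw [← hPadd l hl.2 m hm.2, hlm]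
      rfl
    rw [this]
    exact hl.1
  have hsymm : ∀ x : L, (x : W) ∈ U → (e.symm x : W) ∈ U := by
    intro x hx
    let φ : sect U N → sect U L := fun z => ⟨p ⟨z, z.2.2⟩, hpsect _ z.2.1, (p ⟨z, z.2.2⟩).2⟩
    have hφ : Function.Bijective φ := by
      rw [Nat.bijective_iff_injective_and_card]
      refine ⟨fun z z' hzz => ?_, by rw [hN.2, hL.2]⟩
      have h1 : p ⟨z, z.2.2⟩ = p ⟨z', z'.2.2⟩ := by
        have := congrArg Subtype.val hzz
        exact Subtype.ext this
      have h2 := hpinj h1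
      exact Subtype.ext (by have h := congrArg Subtype.val h2; exact h)
    obtain ⟨z, hz⟩ := hφ.2 ⟨x, hx, x.2⟩
    have h1 : e ⟨z, z.2.2⟩ = x := Subtype.ext (by have h := congrArg Subtype.val hz; exact h)
    rw [← h1, LinearEquiv.symm_apply_apply]
    exact z.2.1
  have hPe : ∀ x : L, P (e.symm x) = x := fun x => e.apply_symm_apply x
  refine ⟨N.subtype ∘ₗ (e.symm : L →ₗ[F] N) - L.subtype, fun x => ?_, fun x hx => ?_, ?_⟩
  · have := hPM _ (e.symm x).2
    rw [hPe] at this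
    exact this
  · exact U.sub_mem (hsymm x hx) hx
  · have h1 : e ⟨w + u, hwuN⟩ = ⟨w, hw.2⟩ := hPadd w hw.2 u hu.2
    have h2 : e.symm ⟨w, hw.2⟩ = ⟨w + u, hwuN⟩ := by rw [← h1, LinearEquiv.symm_apply_apply]
    simp [h2]

/-- A map in `homs U L` with a nontrivial kernel vanishes: kernel and image are then at most
one-dimensional, hence contain at most two vectors of `U` each, but there are at least `16` vectors
of `U` on `L`. -/
lemma injective_of_mem_homs (G : SecantGeometry F k U) {L : Submodule F W} (hL : IsSecant U L)
    {g : L →ₗ[F] W} (hg : g ∈ homs U L) (hg0 : g ≠ 0) : Function.Injective g := by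
  have := G.finite_space
  rw [← LinearMap.ker_eq_bot]
  by_contra hker
  have h1 := g.finrank_range_add_finrank_ker
  rw [hL.1] at h1
  have h2 := Submodule.one_le_finrank_iff.2 hker
  have h3 : 1 ≤ finrank F (LinearMap.range g) :=
    Submodule.one_le_finrank_iff.2 fun h => hg0 (LinearMap.range_eq_bot.1 h)
  set A := U.comap L.subtype.toAddMonoidHom with hA
  have h4 := card_inf_ker_mul_card_map g.toAddMonoidHom A
  rw [hA, card_comap_subtype, hL.2, ← hA] at h4
  have h5 : Nat.card ↥(A.map g.toAddMonoidHom) ≤ 2 := by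
    refine (AddSubgroup.card_le_of_le ?_).trans
      (G.scattered.card_sect_le_two (P := LinearMap.range g) (by omega))
    rintro _ ⟨x, hx, rfl⟩
    exact ⟨hg x hx, x, rfl⟩
  have h6 : Nat.card ↥(A ⊓ g.toAddMonoidHom.ker) ≤ 2 := by
    have hdim : finrank F ((LinearMap.ker g).map L.subtype) ≤ 1 :=
      (Submodule.finrank_map_le _ _).trans (by omega)
    refine (Nat.card_le_card_of_injective
      (fun x : ↥(A ⊓ g.toAddMonoidHom.ker) =>
        (⟨x.1.1, x.2.1, Submodule.mem_map_of_mem (f := L.subtype)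
          (show x.1 ∈ LinearMap.ker g from x.2.2)⟩ :
          sect U ((LinearMap.ker g).map L.subtype))) ?_).trans
      (G.scattered.card_sect_le_two hdim)
    intro x y hxy
    exact Subtype.ext (Subtype.ext (by have h := congrArg Subtype.val hxy; exact h))
  have h7 := Nat.mul_le_mul h6 h5
  have := G.le_card
  omega

lemma homs_ext (G : SecantGeometry F k U) {L : Submodule F W} (hL : IsSecant U L)
    {g g' : L →ₗ[F] W} (hg : g ∈ homs U L) (hg' : g' ∈ homs U L) {z : L} (hz : z ≠ 0)
    (h : g z = g' z) : g = g' := by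
  by_contra hne
  have := G.injective_of_mem_homs hL ((homs U L).sub_mem hg hg') (sub_ne_zero.2 hne)
  exact hz (this (by simp [h]))

lemma stab_ext (G : SecantGeometry F k U) {L : Submodule F W} (hL : IsSecant U L)
    {e e' : End F L} (he : e ∈ stab U L) (he' : e' ∈ stab U L) {z : L} (hz : z ≠ 0)
    (h : e z = e' z) : e = e' := by
  have := G.homs_ext hL (subtype_comp_mem_homs he) (subtype_comp_mem_homs he') hz (by simp [h])
  ext x
  exact congrArg (fun g => g x) this

lemma injective_of_mem_stab (G : SecantGeometry F k U) {L : Submodule F W} (hL : IsSecant U L)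
    {e : End F L} (he : e ∈ stab U L) (he0 : e ≠ 0) : Function.Injective e := by
  rw [injective_iff_map_eq_zero]
  intro z hz
  by_contra hz0
  exact he0 (G.stab_ext hL he (stab U L).zero_mem hz0 (by simp [hz]))

/-- Going to a second secant and back shows that `stab U L` is transitive on the nonzero vectors
of `U` on `L`. -/
lemma exists_stab (G : SecantGeometry F k U) {L : Submodule F W} (hL : IsSecant U L)
    {w u : L} (hw : (w : W) ∈ U) (hw0 : w ≠ 0) (hu : (u : W) ∈ U) :
    ∃ e ∈ stab U L, e w = u := by
  by_cases hu0 : u = 0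
  · exact ⟨0, (stab U L).zero_mem, by simp [hu0]⟩
  obtain ⟨M, hM, hML⟩ := G.exists_secant_ne hL
  obtain ⟨m, hm, hm0⟩ := G.exists_mem_sect_ne_zero hM
  obtain ⟨g, hgM, hg, hgw⟩ := G.exists_hom hL hM hML.symm ⟨hw, w.2⟩ (by simpa using hw0) hm hm0
  obtain ⟨g', hgL, hg', hgm⟩ := G.exists_hom hM hL hML hm hm0 ⟨hu, u.2⟩ (by simpa using hu0)
  refine ⟨g'.codRestrict L hgL ∘ₗ g.codRestrict M hgM, fun x hx => hg' _ (hg x hx), ?_⟩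
  have : g.codRestrict M hgM w = ⟨m, hm.2⟩ := Subtype.ext hgw
  rw [LinearMap.comp_apply, this]
  exact Subtype.ext hgm

lemma exists_mem_homs (G : SecantGeometry F k U) {L : Submodule F W} (hL : IsSecant U L)
    {w : L} (hw : (w : W) ∈ U) (hw0 : w ≠ 0) {u : W} (hu : u ∈ U) :
    ∃ g ∈ homs U L, g w = u := by
  by_cases huL : u ∈ L
  · obtain ⟨e, he, hew⟩ := G.exists_stab hL hw hw0 (u := ⟨u, huL⟩) hu
    exact ⟨_, subtype_comp_mem_homs he, by simp [hew]⟩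
  · have hu0 : u ≠ 0 := fun h => huL (h ▸ L.zero_mem)
    obtain ⟨M, hM, huM⟩ := G.exists_secant hu hu0
    obtain ⟨g, -, hg, hgw⟩ := G.exists_hom hL hM (fun h => huL (h ▸ huM)) ⟨hw, w.2⟩
      (by simpa using hw0) ⟨hu, huM⟩ hu0
    exact ⟨g, hg, hgw⟩

lemma card_homs (G : SecantGeometry F k U) {L : Submodule F W} (hL : IsSecant U L) :
    Nat.card (homs U L) = Nat.card F ^ k := by
  obtain ⟨w, hw, hw0⟩ := G.exists_mem_sect_ne_zero hL
  have hw0' : (⟨w, hw.2⟩ : L) ≠ 0 := by simpa using hw0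
  rw [← G.card_eq]
  refine Nat.card_congr (Equiv.ofBijective (fun g => ⟨g.1 ⟨w, hw.2⟩, g.2 _ hw.1⟩) ⟨?_, ?_⟩)
  · intro g g' h
    exact Subtype.ext (G.homs_ext hL g.2 g'.2 hw0' (congrArg Subtype.val h))
  · rintro ⟨u, hu⟩
    obtain ⟨g, hg, hgw⟩ := G.exists_mem_homs hL (w := ⟨w, hw.2⟩) hw.1 hw0' hu
    exact ⟨⟨g, hg⟩, Subtype.ext hgw⟩

lemma card_stab (G : SecantGeometry F k U) {L : Submodule F W} (hL : IsSecant U L) :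
    Nat.card (stab U L) = Nat.card F := by
  obtain ⟨w, hw, hw0⟩ := G.exists_mem_sect_ne_zero hL
  have hw0' : (⟨w, hw.2⟩ : L) ≠ 0 := by simpa using hw0
  rw [← hL.2]
  refine Nat.card_congr (Equiv.ofBijective
    (fun e => ⟨e.1 ⟨w, hw.2⟩, e.2 _ hw.1, (e.1 ⟨w, hw.2⟩).2⟩) ⟨?_, ?_⟩)
  · intro e e' h
    exact Subtype.ext (G.stab_ext hL e.2 e'.2 hw0'
      (Subtype.ext (by have h' := congrArg Subtype.val h; exact h')))
  · rintro ⟨u, hu⟩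
    obtain ⟨e, he, hew⟩ := G.exists_stab hL (w := ⟨w, hw.2⟩) hw.1 hw0' (u := ⟨u, hu.2⟩) hu.1
    exact ⟨⟨e, he⟩, Subtype.ext (by have h := congrArg Subtype.val hew; exact h)⟩

/-- `stab U L` is a finite domain, hence commutative by Wedderburn's theorem; as it has as many
elements as `F`, each of them is a root of `X ^ q - X`. -/
lemma stab_comm_and_pow (G : SecantGeometry F k U) {L : Submodule F W} (hL : IsSecant U L) :
    (∀ e ∈ stab U L, ∀ e' ∈ stab U L, e * e' = e' * e) ∧
      ∀ e ∈ stab U L, e ^ Nat.card F = e := by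
  have hfin : Finite (stab U L) :=
    Nat.finite_of_card_ne_zero (by rw [G.card_stab hL]; have := G.le_card; omega)
  have hnt : Nontrivial (stab U L) :=
    (Finite.one_lt_card_iff_nontrivial).1 (by rw [G.card_stab hL]; have := G.le_card; omega)
  have hdom : IsDomain (stab U L) := by
    have : NoZeroDivisors (stab U L) := by
      refine ⟨fun {e e'} h => ?_⟩
      by_contra! hne
      have h1 := G.injective_of_mem_stab hL e.2 (by simpa using hne.1)
      apply hne.2
      ext x : 2
      apply h1
      have := congrArg (fun t : stab U L => (t : End F L) x) h
      simpa using this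
    exact NoZeroDivisors.to_isDomain _
  have hF := Finite.isDomain_to_isField (stab U L)
  refine ⟨fun e he e' he' => congrArg Subtype.val (hF.mul_comm ⟨e, he⟩ ⟨e', he'⟩), fun e he => ?_⟩
  let := hF.toField
  let := Fintype.ofFinite (stab U L)
  have := FiniteField.pow_card (⟨e, he⟩ : stab U L)
  rw [← Nat.card_eq_fintype_card, G.card_stab hL] at this
  exact congrArg Subtype.val this

end SecantGeometry

end

/-! ### Transversal spaces -/

section

variable {F W : Type*} [Field F] [AddCommGroup W] [Module F W]

lemma injective_aeval_prod_X_sub_C {L : Type*} [AddCommGroup L] [Module F L] (e : End F L)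
    (s : Finset F) (h : ∀ c ∈ s, Function.Injective (e - algebraMap F (End F L) c)) :
    Function.Injective (Polynomial.aeval e (∏ c ∈ s, (Polynomial.X - Polynomial.C c))) := by
  classical
  induction s using Finset.induction_on with
  | empty =>
    rw [Finset.prod_empty, map_one]
    exact Function.injective_id
  | insert c s hc ih =>
    rw [Finset.prod_insert hc, map_mul, Module.End.mul_eq_comp, LinearMap.coe_comp]
    refine Function.Injective.comp ?_ (ih fun d hd => h d (Finset.mem_insert_of_mem hd))
    simpa using h c (Finset.mem_insert_self c s)

lemma prod_X_sub_C_eq_X_pow_card_sub_X [Fintype F] :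
    ∏ c : F, (Polynomial.X - Polynomial.C c) =
      (Polynomial.X ^ Fintype.card F - Polynomial.X : Polynomial F) := by
  have h1 := FiniteField.roots_X_pow_card_sub_X F
  have h2 : (Polynomial.X ^ Fintype.card F - Polynomial.X : Polynomial F).Monic :=
    Polynomial.monic_X_pow_sub (by
      rw [Polynomial.degree_X]
      exact_mod_cast Fintype.one_lt_card (α := F))
  have h3 := Polynomial.prod_multiset_X_sub_C_of_monic_of_roots_card_eq h2 (by
    rw [h1, FiniteField.X_pow_card_sub_X_natDegree_eq F Fintype.one_lt_card]
    rfl)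
  rw [h1] at h3
  exact h3

/-- A common eigenvector of the endomorphisms in `stab U L`. -/
def IsEigen (U : AddSubgroup W) (L : Submodule F W) (a : L) : Prop :=
  a ≠ 0 ∧ ∀ e ∈ stab U L, ∃ c : F, e a = c • a

lemma natCard_ne {X : Type*} [Finite X] (a : X) : Nat.card {x : X // x ≠ a} = Nat.card X - 1 := by
  have h := Set.ncard_compl ({a} : Set X)
  rw [Set.ncard_singleton] at h
  exact h

namespace SecantGeometry

variable {k : ℕ} {U : AddSubgroup W}

lemma isEigen_of_apply_eq_smul (G : SecantGeometry F k U) {L : Submodule F W}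
    (hL : IsSecant U L) {e : End F L} (he : e ∈ stab U L) {c : F}
    (hec : e ≠ algebraMap F (End F L) c) {a : L} (ha0 : a ≠ 0) (ha : e a = c • a) :
    IsEigen U L a := by
  have := G.finiteDimensional
  refine ⟨ha0, fun e' he' => ?_⟩
  by_contra hno
  have h1 : e' a ∉ Submodule.span F {a} := fun h => by
    obtain ⟨d, hd⟩ := Submodule.mem_span_singleton.1 h
    exact hno ⟨d, hd.symm⟩
  have h2 := finrank_span_pair_eq_two ha0 h1
  have h3 : Submodule.span F {a, e' a} ≤ LinearMap.ker (e - algebraMap F (End F L) c) := by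
    rw [Submodule.span_le, Set.insert_subset_iff, Set.singleton_subset_iff]
    constructor
    · simp [ha]
    · have : e (e' a) = e' (e a) :=
        congrArg (fun t : End F L => t a) ((G.stab_comm_and_pow hL).1 e he e' he')
      simp [this, ha]
  have h4 := Submodule.finrank_mono h3
  have h5 : LinearMap.ker (e - algebraMap F (End F L) c) = ⊤ := by
    refine Submodule.eq_top_of_finrank_eq (le_antisymm (Submodule.finrank_le _) ?_)
    rw [hL.1]
    omega
  exact hec (sub_eq_zero.1 (LinearMap.ker_eq_top.1 h5))

/-- An endomorphism in `stab U L` moving a vector of `U` off its point is not a scalar. As a root of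
`X ^ q - X`, it is diagonalizable, and its two eigenvectors are common to `stab U L`, which is
commutative. -/
lemma exists_eigenvectors (G : SecantGeometry F k U) {L : Submodule F W} (hL : IsSecant U L) :
    ∃ a b : L, IsEigen U L a ∧ IsEigen U L b ∧ b ∉ Submodule.span F {a} := by
  classical
  have := G.finite
  have : Fintype F := Fintype.ofFinite F
  obtain ⟨w, hw, hw0⟩ := G.exists_mem_sect_ne_zero hL
  obtain ⟨w', hw', hww'⟩ := G.exists_mem_sect_notMem hL (P := Submodule.span F {w})
    (finrank_span_singleton hw0).le
  obtain ⟨e, he, hew⟩ := G.exists_stab hL (w := ⟨w, hw.2⟩) (u := ⟨w', hw'.2⟩) hw.1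
    (by simpa using hw0) hw'.1
  have hns : ∀ c : F, e ≠ algebraMap F (End F L) c := by
    rintro c rfl
    refine hww' (Submodule.mem_span_singleton.2 ⟨c, ?_⟩)
    have h := congrArg Subtype.val hew
    simpa using h
  have hzero : Polynomial.aeval e (∏ c : F, (Polynomial.X - Polynomial.C c)) = 0 := by
    rw [prod_X_sub_C_eq_X_pow_card_sub_X, ← Nat.card_eq_fintype_card, map_sub, map_pow,
      Polynomial.aeval_X, (G.stab_comm_and_pow hL).2 e he, sub_self]
  have hex : ∀ c : F, ¬ Function.Injective (e - algebraMap F (End F L) c) →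
      ∃ a : L, a ≠ 0 ∧ e a = c • a := by
    intro c hc
    rw [injective_iff_map_eq_zero] at hc
    push Not at hc
    obtain ⟨a, ha, ha0⟩ := hc
    exact ⟨a, ha0, by simpa [sub_eq_zero] using ha⟩
  obtain ⟨c, hc⟩ : ∃ c : F, ¬ Function.Injective (e - algebraMap F (End F L) c) := by
    by_contra h
    push Not at h
    have h1 := injective_aeval_prod_X_sub_C e Finset.univ fun c _ => h c
    rw [hzero] at h1
    have h2 : (⟨w, hw.2⟩ : L) = 0 := h1 (by simp)
    exact hw0 (congrArg Subtype.val h2)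
  obtain ⟨d, hdc, hd⟩ : ∃ d : F, d ≠ c ∧ ¬ Function.Injective (e - algebraMap F (End F L) d) := by
    by_contra h
    push Not at h
    have h1 := injective_aeval_prod_X_sub_C e (Finset.univ.erase c) fun d hd =>
      h d (Finset.ne_of_mem_erase hd)
    rw [← Finset.prod_erase_mul _ _ (Finset.mem_univ c), map_mul] at hzero
    refine hns c (sub_eq_zero.1 (LinearMap.ext fun x => h1 ?_))
    have := congrArg (fun t : End F L => t x) hzero
    simpa using this
  obtain ⟨a, ha0, ha⟩ := hex c hc
  obtain ⟨b, hb0, hb⟩ := hex d hd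
  refine ⟨a, b, G.isEigen_of_apply_eq_smul hL he (hns c) ha0 ha,
    G.isEigen_of_apply_eq_smul hL he (hns d) hb0 hb, fun hab => ?_⟩
  obtain ⟨t, rfl⟩ := Submodule.mem_span_singleton.1 hab
  rw [map_smul, ha, smul_comm t c a, ← sub_eq_zero, ← sub_smul] at hb
  rcases smul_eq_zero.1 hb with h | h
  · exact hdc (sub_eq_zero.1 h).symm
  · exact hb0 h

/-- The eigenvalue of `a` determines an element of `stab U L`, which has the same order as `F`. -/
lemma exists_stab_apply_eq_smul (G : SecantGeometry F k U) {L : Submodule F W}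
    (hL : IsSecant U L) {a : L} (ha : IsEigen U L a) (c : F) :
    ∃ e ∈ stab U L, e a = c • a := by
  have := G.finite
  choose χ hχ using fun e : stab U L => ha.2 e e.2
  have hbij : Function.Bijective χ := by
    rw [Nat.bijective_iff_injective_and_card]
    refine ⟨fun e e' h => ?_, G.card_stab hL⟩
    exact Subtype.ext (G.stab_ext hL e.2 e'.2 ha.1 (by rw [hχ, hχ, h]))
  obtain ⟨e, rfl⟩ := hbij.2 c
  exact ⟨e, e.2, hχ e⟩

/-- The point spanned by an eigenvector is missed by `U`: the orbit of a vector of `U` in it would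
consist of all vectors of `U` on `L`. -/
lemma eq_zero_of_smul_eigen_mem (G : SecantGeometry F k U) {L : Submodule F W}
    (hL : IsSecant U L) {a : L} (ha : IsEigen U L a) {c : F} (hc : c • (a : W) ∈ U) : c = 0 := by
  by_contra hc0
  have ha0 : (a : W) ≠ 0 := by simpa using ha.1
  obtain ⟨u, hu, hua⟩ := G.exists_mem_sect_notMem hL (P := Submodule.span F {(a : W)})
    (finrank_span_singleton ha0).le
  obtain ⟨e, he, hea⟩ := G.exists_stab hL (w := c • a) (u := ⟨u, hu.2⟩) hc
    (smul_ne_zero hc0 ha.1) hu.1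
  obtain ⟨d, hd⟩ := ha.2 e he
  rw [map_smul, hd, smul_smul] at hea
  exact hua (Submodule.mem_span_singleton.2 ⟨c * d, congrArg Subtype.val hea⟩)

lemma isSecant_range (G : SecantGeometry F k U) {L : Submodule F W} (hL : IsSecant U L)
    {g : L →ₗ[F] W} (hg : g ∈ homs U L) (hg0 : g ≠ 0) : IsSecant U (LinearMap.range g) := by
  have := G.finite_space
  have hinj := G.injective_of_mem_homs hL hg hg0
  have h2 : finrank F (LinearMap.range g) = 2 := by rw [LinearMap.finrank_range_of_inj hinj, hL.1]
  refine ⟨h2, (G.card_sect _ h2).resolve_left fun h => ?_⟩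
  have h3 : Nat.card (sect U L) ≤ Nat.card (sect U (LinearMap.range g)) :=
    Nat.card_le_card_of_injective
      (fun x => ⟨g ⟨x, x.2.2⟩, hg _ x.2.1, ⟨x, x.2.2⟩, rfl⟩) fun x y hxy => by
        have h := hinj (congrArg Subtype.val hxy)
        exact Subtype.ext (by have h' := congrArg Subtype.val h; exact h')
  rw [hL.2] at h3
  have := G.le_card
  omega

lemma mem_of_apply_mem (G : SecantGeometry F k U) {L : Submodule F W} (hL : IsSecant U L)
    {g : L →ₗ[F] W} (hg : g ∈ homs U L) (hg0 : g ≠ 0) {x : L} (hx : g x ∈ U) : (x : W) ∈ U := by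
  have := G.finite_space
  have hinj := G.injective_of_mem_homs hL hg hg0
  let φ : sect U L → sect U (LinearMap.range g) :=
    fun x => ⟨g ⟨x, x.2.2⟩, hg _ x.2.1, ⟨x, x.2.2⟩, rfl⟩
  have hφ : Function.Bijective φ := by
    rw [Nat.bijective_iff_injective_and_card]
    refine ⟨fun x y hxy => ?_, by rw [hL.2, (G.isSecant_range hL hg hg0).2]⟩
    have h := hinj (congrArg Subtype.val hxy)
    exact Subtype.ext (by have h' := congrArg Subtype.val h; exact h')
  obtain ⟨y, hy⟩ := hφ.2 ⟨g x, hx, x, rfl⟩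
  have h1 : g ⟨y, y.2.2⟩ = g x := congrArg Subtype.val hy
  rw [← hinj h1]
  exact y.2.1

lemma exists_homs_range_eq (G : SecantGeometry F k U) {L M : Submodule F W} (hL : IsSecant U L)
    (hM : IsSecant U M) : ∃ g ∈ homs U L, g ≠ 0 ∧ LinearMap.range g = M := by
  obtain ⟨w, hw, hw0⟩ := G.exists_mem_sect_ne_zero hL
  obtain ⟨u, hu, hu0⟩ := G.exists_mem_sect_ne_zero hM
  obtain ⟨g, hg, hgw⟩ := G.exists_mem_homs hL (w := ⟨w, hw.2⟩) hw.1 (by simpa using hw0) hu.1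
  have hg0 : g ≠ 0 := by
    rintro rfl
    exact hu0 hgw.symm
  exact ⟨g, hg, hg0, G.eq_of_mem (G.isSecant_range hL hg hg0) hM hu0 ⟨_, hgw⟩ hu.2⟩

/-- The transversal space attached to a common eigenvector `a` of `stab U L`: it consists of the
images of `a` under the maps in `homs U L`. It is closed under scalar multiplication because every
scalar is an eigenvalue of `a`. -/
def transversal (G : SecantGeometry F k U) {L : Submodule F W} (hL : IsSecant U L) {a : L}
    (ha : IsEigen U L a) : Submodule F W where
  carrier := {x | ∃ g ∈ homs U L, g a = x}
  add_mem' := by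
    rintro _ _ ⟨g, hg, rfl⟩ ⟨g', hg', rfl⟩
    exact ⟨g + g', (homs U L).add_mem hg hg', rfl⟩
  zero_mem' := ⟨0, (homs U L).zero_mem, rfl⟩
  smul_mem' := by
    rintro c _ ⟨g, hg, rfl⟩
    obtain ⟨e, he, hea⟩ := G.exists_stab_apply_eq_smul hL ha c
    exact ⟨g ∘ₗ e, comp_mem_homs hg he, by rw [LinearMap.comp_apply, hea, map_smul]⟩

lemma finrank_transversal (G : SecantGeometry F k U) {L : Submodule F W} (hL : IsSecant U L)
    {a : L} (ha : IsEigen U L a) : finrank F (G.transversal hL ha) = k := by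
  have := G.finiteDimensional
  have h1 : Nat.card (homs U L) = Nat.card (G.transversal hL ha) := by
    refine Nat.card_congr (Equiv.ofBijective (fun g => ⟨g.1 a, g.1, g.2, rfl⟩) ⟨?_, ?_⟩)
    · intro g g' h
      exact Subtype.ext (G.homs_ext hL g.2 g'.2 ha.1 (congrArg Subtype.val h))
    · rintro ⟨_, g, hg, rfl⟩
      exact ⟨⟨g, hg⟩, rfl⟩
  rw [G.card_homs hL, Module.natCard_eq_pow_finrank (K := F) (V := G.transversal hL ha)] at h1
  exact (Nat.pow_right_injective (a := Nat.card F) (by have := G.le_card; omega) h1).symm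

lemma eq_zero_of_mem_transversal (G : SecantGeometry F k U) {L : Submodule F W}
    (hL : IsSecant U L) {a : L} (ha : IsEigen U L a) {x : W} (hx : x ∈ G.transversal hL ha)
    (hxU : x ∈ U) : x = 0 := by
  obtain ⟨g, hg, rfl⟩ := hx
  by_contra h0
  have hg0 : g ≠ 0 := by
    rintro rfl
    exact h0 rfl
  have h1 := G.mem_of_apply_mem hL hg hg0 hxU
  exact one_ne_zero (G.eq_zero_of_smul_eigen_mem hL ha (c := 1) (by simpa using h1))

lemma exists_mem_transversal (G : SecantGeometry F k U) {L M : Submodule F W}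
    (hL : IsSecant U L) {a : L} (ha : IsEigen U L a) (hM : IsSecant U M) :
    ∃ x ∈ G.transversal hL ha, x ∈ M ∧ x ≠ 0 := by
  obtain ⟨g, hg, hg0, rfl⟩ := G.exists_homs_range_eq hL hM
  refine ⟨g a, ⟨g, hg, rfl⟩, ⟨a, rfl⟩, fun h => ha.1 ?_⟩
  exact G.injective_of_mem_homs hL hg hg0 (by rw [h, map_zero])

lemma disjoint_transversal (G : SecantGeometry F k U) {L : Submodule F W}
    (hL : IsSecant U L) {a b : L} (ha : IsEigen U L a) (hb : IsEigen U L b)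
    (hab : b ∉ Submodule.span F {a}) :
    Disjoint (G.transversal hL ha) (G.transversal hL hb) := by
  rw [Submodule.disjoint_def]
  rintro _ ⟨g, hg, rfl⟩ ⟨g', hg', hgg⟩
  by_contra h0
  have hg0 : g ≠ 0 := by
    rintro rfl
    exact h0 rfl
  have hg0' : g' ≠ 0 := by
    rintro rfl
    exact h0 hgg.symm
  have hr := G.eq_of_mem (G.isSecant_range hL hg hg0) (G.isSecant_range hL hg' hg0') h0
    ⟨a, rfl⟩ ⟨b, hgg⟩
  have hinj := G.injective_of_mem_homs hL hg' hg0'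
  have hmem : ∀ x, g x ∈ LinearMap.range g' := fun x => hr ▸ ⟨x, rfl⟩
  set e : End F L := (LinearEquiv.ofInjective g' hinj).symm.toLinearMap ∘ₗ
    g.codRestrict (LinearMap.range g') hmem with he
  have hge : ∀ x, g' (e x) = g x := by
    intro x
    have := (LinearEquiv.ofInjective g' hinj).apply_symm_apply
      (g.codRestrict (LinearMap.range g') hmem x)
    exact congrArg Subtype.val this
  have hes : e ∈ stab U L := fun x hx =>
    G.mem_of_apply_mem hL hg' hg0' (by rw [hge]; exact hg x hx)
  obtain ⟨c, hc⟩ := ha.2 e hes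
  refine hab (Submodule.mem_span_singleton.2 ⟨c, ?_⟩)
  rw [← hc]
  exact hinj (by rw [hge, hgg])

/-- A secant has `q + 1` points: the `q - 1` points of the linear set and the two points spanned by
eigenvectors. -/
lemma exists_smul_mem_or_mem_span (G : SecantGeometry F k U) {L : Submodule F W}
    (hL : IsSecant U L) {a b : L} (ha : IsEigen U L a) (hb : IsEigen U L b)
    (hab : b ∉ Submodule.span F {a}) {y : L} (hy : y ≠ 0) :
    (∃ c : F, c ≠ 0 ∧ c • (y : W) ∈ U) ∨ y ∈ Submodule.span F {a} ∨ y ∈ Submodule.span F {b} := by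
  have := G.finite
  have := G.finite_space
  let f : (Fˣ × {w : sect U L // w ≠ 0}) ⊕ (Fˣ ⊕ Fˣ) → {y : L // y ≠ 0}
    | .inl (c, w) => ⟨c • ⟨w.1, w.1.2.2⟩, (smul_ne_zero_iff_ne c).2 fun h =>
        w.2 (Subtype.ext (by have h' := congrArg Subtype.val h; exact h'))⟩
    | .inr (.inl c) => ⟨c • a, (smul_ne_zero_iff_ne c).2 ha.1⟩
    | .inr (.inr c) => ⟨c • b, (smul_ne_zero_iff_ne c).2 hb.1⟩
  -- a multiple of an eigenvector is not proportional to a vector of `U`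
  have hcross : ∀ (d : L), IsEigen U L d → ∀ (c c' : Fˣ) (w : {w : sect U L // w ≠ 0}),
      (c • (⟨w.1, w.1.2.2⟩ : L)) ≠ c' • d := by
    intro d hd c c' w h
    have h1 : (w.1 : W) = (c⁻¹ * c' : Fˣ) • (d : W) := by
      have h' : c • (w.1 : W) = c' • (d : W) := congrArg Subtype.val h
      rw [mul_smul, ← h', inv_smul_smul]
    have h2 := w.1.2.1
    rw [h1] at h2
    exact (c⁻¹ * c').ne_zero (G.eq_zero_of_smul_eigen_mem hL hd h2)
  have hne : ∀ c c' : Fˣ, c • a ≠ c' • b := by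
    intro c c' h
    refine hab (Submodule.mem_span_singleton.2 ⟨(c'⁻¹ * c : Fˣ), ?_⟩)
    change (c'⁻¹ * c) • a = b
    rw [mul_smul, h, inv_smul_smul]
  have hcancel : ∀ (d : L), IsEigen U L d → ∀ c c' : Fˣ, c • d = c' • d → c = c' := by
    intro d hd c c' h
    exact Units.ext (smul_left_injective F hd.1 h)
  have hf : Function.Injective f := by
    rintro (⟨c, w⟩ | c | c) (⟨c', w'⟩ | c' | c') h <;> have h := congrArg Subtype.val h
    · have h' : (c • (w.1 : W)) = c' • (w'.1 : W) := congrArg Subtype.val h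
      have hw0 : (w.1 : W) ≠ 0 := by simpa using w.2
      have hw0' : (w'.1 : W) ≠ 0 := by simpa using w'.2
      have h1 : (w'.1 : W) = ((c'⁻¹ * c : Fˣ) : F) • (w.1 : W) := by
        change _ = (c'⁻¹ * c) • (w.1 : W)
        rw [mul_smul, h', inv_smul_smul]
      have h2 := w'.1.2.1
      rw [h1] at h2
      rcases G.scattered _ w.1.2.1 hw0 _ h2 with h3 | h3
      · exact absurd h3 (Units.ne_zero _)
      · rw [h3, one_smul] at h1
        have h4 : c = c' := by
          have : c'⁻¹ * c = 1 := Units.ext h3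
          rw [inv_mul_eq_one] at this
          exact this.symm
        rw [h4, Subtype.ext (Subtype.ext h1.symm)]
    · exact absurd h (hcross a ha _ _ _)
    · exact absurd h (hcross b hb _ _ _)
    · exact absurd h.symm (hcross a ha _ _ _)
    · rw [hcancel a ha _ _ h]
    · exact absurd h (hne _ _)
    · exact absurd h.symm (hcross b hb _ _ _)
    · exact absurd h.symm (hne _ _)
    · rw [hcancel b hb _ _ h]
  have hbij : Function.Bijective f := by
    rw [Nat.bijective_iff_injective_and_card]
    refine ⟨hf, ?_⟩
    rw [Nat.card_sum, Nat.card_sum, Nat.card_prod, natCard_ne, natCard_ne, Nat.card_units, hL.2,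
      Module.natCard_eq_pow_finrank (K := F) (V := L), hL.1]
    obtain ⟨n, hn⟩ : ∃ n, Nat.card F = n + 1 := ⟨Nat.card F - 1, by have := G.le_card; omega⟩
    rw [hn, Nat.add_sub_cancel, show (n + 1) ^ 2 = n * n + (n + n) + 1 by ring,
      Nat.add_sub_cancel]
  obtain ⟨x, hx⟩ := hbij.2 ⟨y, hy⟩
  have hx := congrArg Subtype.val hx
  rcases x with ⟨c, w⟩ | c | c
  · left
    refine ⟨(c⁻¹ : Fˣ), Units.ne_zero _, ?_⟩
    have h1 : c • (w.1 : W) = y := congrArg Subtype.val hx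
    change c⁻¹ • (y : W) ∈ U
    rw [← h1, inv_smul_smul]
    exact w.1.2.1
  · exact Or.inr (Or.inl (Submodule.mem_span_singleton.2 ⟨c, hx⟩))
  · exact Or.inr (Or.inr (Submodule.mem_span_singleton.2 ⟨c, hx⟩))

lemma mem_transversal_or_mem_transversal (G : SecantGeometry F k U) {L M : Submodule F W}
    (hL : IsSecant U L) {a b : L} (ha : IsEigen U L a) (hb : IsEigen U L b)
    (hab : b ∉ Submodule.span F {a}) (hM : IsSecant U M) {z : W} (hz : z ∈ M) (hz0 : z ≠ 0)
    (hzU : ∀ c : F, c ≠ 0 → c • z ∉ U) :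
    z ∈ G.transversal hL ha ∨ z ∈ G.transversal hL hb := by
  obtain ⟨g, hg, hg0, rfl⟩ := G.exists_homs_range_eq hL hM
  obtain ⟨y, rfl⟩ := hz
  have hy0 : y ≠ 0 := by
    rintro rfl
    exact hz0 (map_zero g)
  rcases G.exists_smul_mem_or_mem_span hL ha hb hab hy0 with ⟨c, hc, hcy⟩ | h | h
  · refine absurd (hg (c • y) hcy) ?_
    rw [map_smul]
    exact hzU c hc
  · obtain ⟨c, rfl⟩ := Submodule.mem_span_singleton.1 h
    left
    rw [map_smul]
    exact Submodule.smul_mem _ _ ⟨g, hg, rfl⟩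
  · obtain ⟨c, rfl⟩ := Submodule.mem_span_singleton.1 h
    right
    rw [map_smul]
    exact Submodule.smul_mem _ _ ⟨g, hg, rfl⟩

/-- The secants partition the nonzero vectors of `U`. -/
lemma card_secants (G : SecantGeometry F k U) :
    Nat.card {L : Submodule F W // IsSecant U L} * (Nat.card F - 1) = Nat.card F ^ k - 1 := by
  have := G.finite_space
  have : Fintype {L : Submodule F W // IsSecant U L} := Fintype.ofFinite _
  have h1 : Nat.card (Σ L : {L : Submodule F W // IsSecant U L}, {w : sect U L.1 // w ≠ 0}) =
      Nat.card {u : U // u ≠ 0} := by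
    refine Nat.card_congr (Equiv.ofBijective
      (fun x => ⟨⟨x.2.1, x.2.1.2.1⟩, by
        have : (x.2.1 : W) ≠ 0 := by simpa using x.2.2
        simpa using this⟩) ⟨?_, ?_⟩)
    · rintro ⟨⟨L, hL⟩, ⟨⟨w, hw⟩, hw0⟩⟩ ⟨⟨L', hL'⟩, ⟨⟨w', hw'⟩, hw0'⟩⟩ h
      have h1 : w = w' := by
        have h2 := congrArg (fun t => (t.1 : W)) h
        exact h2
      subst h1
      have h2 := G.eq_of_mem hL hL' (z := w) (by simpa using hw0) hw.2 hw'.2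
      subst h2
      rfl
    · rintro ⟨⟨u, hu⟩, hu0⟩
      obtain ⟨L, hL, huL⟩ := G.exists_secant hu (by simpa using hu0)
      exact ⟨⟨⟨L, hL⟩, ⟨⟨u, hu, huL⟩, fun h =>
        hu0 (Subtype.ext (by have h' := congrArg Subtype.val h; exact h'))⟩⟩, rfl⟩
  rw [Nat.card_sigma, natCard_ne, G.card_eq] at h1
  rw [← h1, Finset.sum_congr rfl fun L _ => (natCard_ne (0 : sect U L.1)).trans
    (by rw [L.2.2]), Finset.sum_const, Finset.card_univ, smul_eq_mul, Nat.card_eq_fintype_card]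

/-- A `k`-dimensional subspace missed by `U` that meets all secants contains, for reasons of
cardinality, only points on secants, hence it is covered by the two transversals. -/
lemma eq_transversal_or_eq_transversal (G : SecantGeometry F k U) {L : Submodule F W}
    (hL : IsSecant U L) {a b : L} (ha : IsEigen U L a) (hb : IsEigen U L b)
    (hab : b ∉ Submodule.span F {a}) {T : Submodule F W} (hT : finrank F T = k)
    (hTU : ∀ x ∈ T, x ∈ U → x = 0)
    (hTL : ∀ M : Submodule F W, IsSecant U M → ∃ x ∈ T, x ∈ M ∧ x ≠ 0) :
    T = G.transversal hL ha ∨ T = G.transversal hL hb := by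
  have := G.finite_space
  choose! x hxT hxM hx0 using hTL
  let f : {M : Submodule F W // IsSecant U M} × Fˣ → {y : T // y ≠ 0} := fun p =>
    ⟨p.2 • ⟨x p.1, hxT _ p.1.2⟩, (smul_ne_zero_iff_ne p.2).2 fun h =>
      hx0 _ p.1.2 (congrArg Subtype.val h)⟩
  have hf : Function.Bijective f := by
    rw [Nat.bijective_iff_injective_and_card]
    constructor
    · rintro ⟨⟨M, hM⟩, c⟩ ⟨⟨M', hM'⟩, c'⟩ h
      have h1 : c • x M = c' • x M' := congrArg (fun t => (t.1 : W)) h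
      have h2 : M = M' := G.eq_of_mem hM hM' (z := c • x M)
        ((smul_ne_zero_iff_ne c).2 (hx0 M hM))
        (M.smul_mem _ (hxM M hM)) (h1 ▸ M'.smul_mem _ (hxM M' hM'))
      subst h2
      rw [Units.ext (smul_left_injective F (hx0 M hM) h1)]
    · rw [Nat.card_prod, natCard_ne, Nat.card_units, G.card_secants,
        Module.natCard_eq_pow_finrank (K := F) (V := T), hT]
  have hcov : ∀ y ∈ T, y ∈ G.transversal hL ha ∨ y ∈ G.transversal hL hb := by
    intro y hy
    by_cases hy0 : y = 0
    · exact Or.inl (hy0 ▸ Submodule.zero_mem _)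
    obtain ⟨⟨⟨M, hM⟩, c⟩, hp⟩ := hf.2 ⟨⟨y, hy⟩, by simpa using hy0⟩
    have h1 : c • x M = y := congrArg (fun t => (t.1 : W)) hp
    refine G.mem_transversal_or_mem_transversal hL ha hb hab hM
      (h1 ▸ M.smul_mem _ (hxM M hM)) hy0 fun d hd hdU => ?_
    exact smul_ne_zero hd hy0 (hTU _ (T.smul_mem d hy) hdU)
  have hle : T ≤ G.transversal hL ha ∨ T ≤ G.transversal hL hb := by
    by_contra! h
    obtain ⟨y, hy, hya⟩ := SetLike.not_le_iff_exists.1 h.1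
    obtain ⟨z, hz, hzb⟩ := SetLike.not_le_iff_exists.1 h.2
    have hyb := (hcov y hy).resolve_left hya
    have hza := (hcov z hz).resolve_right hzb
    rcases hcov _ (T.add_mem hy hz) with h1 | h1
    · exact hya ((Submodule.add_mem_iff_left _ hza).1 h1)
    · exact hzb ((Submodule.add_mem_iff_right _ hyb).1 h1)
  exact hle.imp
    (fun h => Submodule.eq_of_le_of_finrank_eq h (by rw [hT, G.finrank_transversal]))
    (fun h => Submodule.eq_of_le_of_finrank_eq h (by rw [hT, G.finrank_transversal]))

end SecantGeometry

end

/-! ### Planes with two secants -/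

section

variable {F W : Type*} [Field F] [AddCommGroup W] [Module F W] [Fintype W]

open Classical in
/-- The lines through the point `⟨p⟩` in the subspace `E`. -/
noncomputable def linesThrough (p : W) (E : Submodule F W) : Finset (Submodule F W) :=
  (Set.toFinite {L : Submodule F W | finrank F L = 2 ∧ p ∈ L ∧ L ≤ E}).toFinset

lemma mem_linesThrough {p : W} {E L : Submodule F W} :
    L ∈ linesThrough p E ↔ finrank F L = 2 ∧ p ∈ L ∧ L ≤ E := by
  simp [linesThrough]

open Classical in
lemma card_eq_sum_linesThrough {p : W} {E : Submodule F W} (hp0 : p ≠ 0) (hp : p ∈ E)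
    (S : Finset W) (hS : ∀ x ∈ S, x ∈ E ∧ x ∉ Submodule.span F {p}) :
    S.card = ∑ L ∈ linesThrough p E, (S.filter (· ∈ L)).card := by
  rw [Finset.card_eq_sum_card_fiberwise (f := fun x => Submodule.span F {p, x})
    (t := linesThrough p E)]
  · refine Finset.sum_congr rfl fun L hL => ?_
    congr 1
    refine Finset.filter_congr fun x hx => ?_
    rw [mem_linesThrough] at hL
    constructor
    · rintro rfl
      exact Submodule.subset_span (by simp)
    · exact span_pair_eq_of_mem hL.1 hp0 (hS x hx).2 hL.2.1
  · intro x hx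
    rw [Finset.mem_coe, mem_linesThrough]
    refine ⟨finrank_span_pair_eq_two hp0 (hS x hx).2, Submodule.subset_span (by simp), ?_⟩
    rw [Submodule.span_le, Set.insert_subset_iff, Set.singleton_subset_iff]
    exact ⟨hp, (hS x hx).1⟩

open Classical in
lemma card_filter_mem (Y : Submodule F W) :
    (Finset.univ.filter (· ∈ Y)).card = Nat.card F ^ finrank F Y := by
  rw [← Module.natCard_eq_pow_finrank (K := F) (V := Y), ← Fintype.card_subtype,
    Nat.card_eq_fintype_card]

open Classical in
lemma card_linesThrough [Finite F] {p : W} {E : Submodule F W} (hE : finrank F E = 3) (hp0 : p ≠ 0)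
    (hp : p ∈ E) : (linesThrough p E).card = Nat.card F + 1 := by
  have hq : 1 < Nat.card F := Finite.one_lt_card
  have key : ∀ Y : Submodule F W, p ∈ Y →
      ((Finset.univ.filter (· ∈ Y)).filter (· ∉ Submodule.span F {p})).card + Nat.card F =
        Nat.card F ^ finrank F Y := by
    intro Y hY
    have h := Finset.card_filter_add_card_filter_not (s := Finset.univ.filter (· ∈ Y))
      (p := fun x => x ∈ Submodule.span F {p})
    rw [card_filter_mem] at h
    have h2 : (Finset.univ.filter (· ∈ Y)).filter (· ∈ Submodule.span F {p}) =
        Finset.univ.filter (· ∈ Submodule.span F {p}) := by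
      ext x
      simp only [Finset.mem_filter, Finset.mem_univ, true_and, and_iff_right_iff_imp]
      intro hx
      exact (Submodule.span_singleton_le_iff_mem p Y).2 hY hx
    rw [h2, card_filter_mem, finrank_span_singleton hp0, pow_one] at h
    omega
  have h1 := card_eq_sum_linesThrough hp0 hp
    ((Finset.univ.filter (· ∈ E)).filter (· ∉ Submodule.span F {p}))
    (fun x hx => by simpa using hx)
  have h2 : ∀ L ∈ linesThrough p E,
      (((Finset.univ.filter (· ∈ E)).filter (· ∉ Submodule.span F {p})).filter (· ∈ L)).card =
        Nat.card F ^ 2 - Nat.card F := by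
    intro L hL
    rw [mem_linesThrough] at hL
    have h3 := key L hL.2.1
    rw [hL.1] at h3
    rw [← h3, Nat.add_sub_cancel]
    congr 1
    ext x
    simp only [Finset.mem_filter, Finset.mem_univ, true_and]
    constructor
    · rintro ⟨⟨-, h⟩, h'⟩
      exact ⟨h', h⟩
    · rintro ⟨h, h'⟩
      exact ⟨⟨hL.2.2 h, h'⟩, h⟩
  have h3 := key E hp
  rw [h1, Finset.sum_congr rfl h2, Finset.sum_const, smul_eq_mul, hE] at h3
  set q := Nat.card F
  set n := (linesThrough p E).card
  obtain ⟨s, hs⟩ : ∃ s, q = s + 1 := ⟨q - 1, by omega⟩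
  have h4 : q ^ 2 - q = s * q := by
    rw [hs, show (s + 1) ^ 2 = s * (s + 1) + (s + 1) by ring, Nat.add_sub_cancel]
  rw [h4] at h3
  have h5 : n * (s * q) = (q + 1) * (s * q) := by
    have : q ^ 3 = (q + 1) * (s * q) + q := by rw [hs]; ring
    omega
  exact Nat.eq_of_mul_eq_mul_right (Nat.mul_pos (by omega) (by omega)) h5

/-- Two distinct lines that meet in a point and carry `q` vectors of `B` each cannot exist, if every
line carries `1`, `2`, `4` or `q` vectors of `B` and, in a plane `E`, the number of vectors of `B`
is `r` times the number on any of its lines, with `r ≤ q` depending on the line. Indeed, with `r`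
taken for one of the two lines, each line of `E` carries at least `r` vectors. For `r ≥ 3` this
leaves two types of lines, the number of lines of each type through a vector of `B` is determined by
`r`, and `q - 1` would divide `2`; for `r = 2` the second line through a vector on the first one
alone yields too many lines carrying `4` vectors. -/
theorem false_of_two_secants [Finite F] (B : Finset W) (hq : 16 ≤ Nat.card F) (h0 : (0 : W) ∈ B)
    (hcol : ∀ p ∈ B, ∀ x ∈ B, p ≠ 0 → x ∈ Submodule.span F {p} → x = 0 ∨ x = p)
    (y : Submodule F W → ℕ) (hy : ∀ L : Submodule F W, ∀ s : Finset W,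
      (∀ x, x ∈ s ↔ x ∈ B ∧ x ∈ L) → s.card = y L)
    (hline : ∀ L : Submodule F W, finrank F L = 2 → y L = 1 ∨ y L = 2 ∨ y L = 4 ∨ y L = Nat.card F)
    {E L₁ L₂ : Submodule F W} (hE : finrank F E = 3)
    (hmul : ∀ L : Submodule F W, finrank F L = 2 → L ≤ E → ∃ r ≤ Nat.card F, y E = r * y L)
    (hL₁ : finrank F L₁ = 2) (hL₂ : finrank F L₂ = 2) (hE₁ : L₁ ≤ E) (hE₂ : L₂ ≤ E)
    (hy₁ : y L₁ = Nat.card F) (hy₂ : y L₂ = Nat.card F) (hne : L₁ ≠ L₂) : False := by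
  classical
  have hy' : ∀ L, (B.filter (· ∈ L)).card = y L := fun L => hy L _ fun x => by simp
  set q := Nat.card F with hqdef
  obtain ⟨r, hr, hm⟩ := hmul L₁ hL₁ hE₁
  rw [hy₁] at hm
  -- every line of the plane carries at least `r` vectors
  have hry : ∀ L : Submodule F W, finrank F L = 2 → L ≤ E → r ≤ y L := by
    intro L hL hLE
    obtain ⟨r', hr', hm'⟩ := hmul L hL hLE
    rw [hm] at hm'
    have : r * q ≤ y L * q := by
      rw [hm', mul_comm (y L)]
      exact Nat.mul_le_mul_right _ hr'
    exact Nat.le_of_mul_le_mul_right this (by omega)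
  -- lines through two vectors
  have hy3 : ∀ p ∈ B, ∀ x ∈ B, p ≠ 0 → x ∉ Submodule.span F {p} →
      3 ≤ y (Submodule.span F {p, x}) := by
    intro p hp x hx hp0 hxp
    rw [← hy', ← (Finset.card_eq_three (s := {0, p, x})).2
      ⟨0, p, x, Ne.symm hp0, fun h => hxp (h ▸ Submodule.zero_mem _),
        fun h => hxp (h ▸ Submodule.mem_span_singleton_self _), rfl⟩]
    refine Finset.card_le_card fun z hz => ?_
    simp only [Finset.mem_insert, Finset.mem_singleton] at hz
    rw [Finset.mem_filter]
    rcases hz with rfl | rfl | rfl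
    · exact ⟨h0, Submodule.zero_mem _⟩
    · exact ⟨hp, Submodule.subset_span (by simp)⟩
    · exact ⟨hx, Submodule.subset_span (by simp)⟩
  set β : W → ℕ := fun p => ((linesThrough p E).filter (fun L => y L = q)).card with hβ
  set α : W → ℕ := fun p => ((linesThrough p E).filter (fun L => y L = 4)).card with hα
  -- the vectors of `B` in the plane, counted on the lines through one of them
  have hcount : ∀ p ∈ B, p ∈ E → p ≠ 0 → r * q = 2 * α p + (q - 2) * β p + 2 := by
    intro p hp hpE hp0
    have h1 := card_eq_sum_linesThrough hp0 hpE (((B.filter (· ∈ E)).erase 0).erase p) (by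
      intro x hx
      simp only [Finset.mem_erase, Finset.mem_filter] at hx
      refine ⟨hx.2.2.2, fun h => ?_⟩
      rcases hcol p hp x hx.2.2.1 hp0 h with h | h
      · exact hx.2.1 h
      · exact hx.1 h)
    have h2 : ∀ Y : Submodule F W, p ∈ Y →
        (((B.filter (· ∈ Y)).erase 0).erase p).card + 2 = y Y := by
      intro Y hpY
      rw [← hy' Y]
      have h3 : (0 : W) ∈ B.filter (· ∈ Y) := by simp [h0]
      have h4 : p ∈ (B.filter (· ∈ Y)).erase 0 := by simp [hp0, hp, hpY]
      rw [← Finset.card_erase_add_one h3, ← Finset.card_erase_add_one h4]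
    have h3 : ∀ L ∈ linesThrough p E,
        ((((B.filter (· ∈ E)).erase 0).erase p).filter (· ∈ L)).card =
          2 * (if y L = 4 then 1 else 0) + (q - 2) * (if y L = q then 1 else 0) := by
      intro L hL
      rw [mem_linesThrough] at hL
      have h4 := h2 L hL.2.1
      have h5 : (((B.filter (· ∈ E)).erase 0).erase p).filter (· ∈ L) =
          ((B.filter (· ∈ L)).erase 0).erase p := by
        ext x
        simp only [Finset.mem_filter, Finset.mem_erase]
        constructor
        · rintro ⟨⟨h, h', h'', -⟩, h4⟩
          exact ⟨h, h', h'', h4⟩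
        · rintro ⟨h, h', h'', h4⟩
          exact ⟨⟨h, h', h'', hL.2.2 h4⟩, h4⟩
      rw [h5]
      rcases hline L hL.1 with h | h | h | h
      · omega
      · rw [if_neg (by omega), if_neg (by omega)]
        omega
      · rw [if_pos h, if_neg (by omega)]
        omega
      · rw [if_neg (by omega), if_pos h]
        omega
    have h4 := h2 E hpE
    rw [h1, Finset.sum_congr rfl h3, Finset.sum_add_distrib, ← Finset.mul_sum, ← Finset.mul_sum,
      ← Finset.card_filter, ← Finset.card_filter, hm] at h4
    exact h4.symm
  have hαβ : ∀ p ∈ B, p ∈ E → p ≠ 0 → 3 ≤ r → α p + β p = q + 1 := by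
    intro p hp hpE hp0 hr3
    rw [hqdef, ← card_linesThrough hE hp0 hpE, hα, hβ]
    simp only
    rw [← Finset.card_union_of_disjoint]
    · congr 1
      rw [← Finset.filter_or]
      refine Finset.filter_true_of_mem fun L hL => ?_
      rw [mem_linesThrough] at hL
      have h1 := hry L hL.1 hL.2.2
      rcases hline L hL.1 with h | h | h | h
      · omega
      · omega
      · exact Or.inl h
      · exact Or.inr h
    · rw [Finset.disjoint_filter]
      intro L _ h h'
      omega
  -- a vector on the first line but not on the second
  obtain ⟨p, hpB, hp₁, hp₂⟩ : ∃ p ∈ B, p ∈ L₁ ∧ p ∉ L₂ := by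
    by_contra hno
    push Not at hno
    by_cases hex : ∃ p ∈ B, p ∈ L₁ ∧ p ≠ 0
    · obtain ⟨p, hpB, hp₁, hp0⟩ := hex
      have h1 : B.filter (· ∈ L₁) ⊆ {0, p} := by
        intro x hx
        rw [Finset.mem_filter] at hx
        rw [Finset.mem_insert, Finset.mem_singleton]
        by_cases hxp : x ∈ Submodule.span F {p}
        · exact hcol p hpB x hx.1 hp0 hxp
        · exact absurd ((span_pair_eq_of_mem hL₁ hp0 hxp hp₁ hx.2).symm.trans
            (span_pair_eq_of_mem hL₂ hp0 hxp (hno p hpB hp₁) (hno x hx.1 hx.2))) hne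
      have h2 := (Finset.card_le_card h1).trans Finset.card_le_two
      rw [hy', hy₁] at h2
      omega
    · push Not at hex
      have h1 : B.filter (· ∈ L₁) ⊆ {0} := by
        intro x hx
        rw [Finset.mem_filter] at hx
        rw [Finset.mem_singleton]
        exact hex x hx.1 hx.2
      have h2 := Finset.card_le_card h1
      rw [hy', hy₁, Finset.card_singleton] at h2
      omega
  have hp0 : p ≠ 0 := fun h => hp₂ (h ▸ L₂.zero_mem)
  have hpE := hE₁ hp₁
  have hcp := hcount p hpB hpE hp0
  have hβ1 : 1 ≤ β p := by
    refine Finset.card_pos.2 ⟨L₁, ?_⟩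
    rw [Finset.mem_filter, mem_linesThrough]
    exact ⟨⟨hL₁, hp₁, hE₁⟩, hy₁⟩
  have hsecond : q - 1 ≤ α p + β p := by
    have h1 : ((B.filter (· ∈ L₂)).erase 0).card = q - 1 := by
      rw [Finset.card_erase_of_mem (by simp [h0]), hy', hy₂]
    rw [← h1, hα, hβ]
    simp only
    rw [← Finset.card_union_of_disjoint]
    · have hnp : ∀ x ∈ (B.filter (· ∈ L₂)).erase 0, x ∉ Submodule.span F {p} := by
        intro x hx hxp
        simp only [Finset.mem_erase, Finset.mem_filter] at hx
        rcases hcol p hpB x hx.2.1 hp0 hxp with h | h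
        · exact hx.1 h
        · exact hp₂ (h ▸ hx.2.2)
      refine Finset.card_le_card_of_injOn (fun x => Submodule.span F {p, x}) ?_ ?_
      · intro x hx
        have hxp := hnp x hx
        simp only [Finset.coe_erase, Set.mem_sdiff, Finset.mem_coe, Finset.mem_filter] at hx
        have h2 := finrank_span_pair_eq_two hp0 hxp
        have h3 : Submodule.span F {p, x} ∈ linesThrough p E := by
          rw [mem_linesThrough]
          refine ⟨h2, Submodule.subset_span (by simp), ?_⟩
          rw [Submodule.span_le, Set.insert_subset_iff, Set.singleton_subset_iff]
          exact ⟨hpE, hE₂ hx.1.2⟩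
        have h4 := hy3 p hpB x hx.1.1 hp0 hxp
        rw [Finset.mem_coe, Finset.mem_union, Finset.mem_filter, Finset.mem_filter]
        rcases hline _ h2 with h | h | h | h
        · omega
        · omega
        · exact Or.inl ⟨h3, h⟩
        · exact Or.inr ⟨h3, h⟩
      · intro x hx x' hx' hxx
        have hxx' : Submodule.span F {p, x} = Submodule.span F {p, x'} := hxx
        have hxp := hnp x hx
        simp only [Finset.coe_erase, Set.mem_sdiff, Finset.mem_coe, Finset.mem_filter,
          Set.mem_singleton_iff] at hx hx'
        by_contra hne'
        have h3 : x' ∉ Submodule.span F {x} := fun h => by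
          rcases hcol x hx.1.1 x' hx'.1.1 hx.2 h with h | h
          · exact hx'.2 h
          · exact hne' h.symm
        have h4 : Submodule.span F {x, x'} = Submodule.span F {p, x} :=
          span_pair_eq_of_mem (finrank_span_pair_eq_two hp0 hxp) hx.2 h3
            (Submodule.subset_span (by simp)) (hxx' ▸ Submodule.subset_span (by simp))
        have h5 := span_pair_eq_of_mem hL₂ hx.2 h3 hx.1.2 hx'.1.2
        apply hp₂
        rw [← h5, h4]
        exact Submodule.subset_span (by simp)
    · rw [Finset.disjoint_filter]
      intro L _ h h'
      omega
  have hr2 : 2 ≤ r := by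
    have h1 : insert p (B.filter (· ∈ L₂)) ⊆ B.filter (· ∈ E) := by
      intro x hx
      rw [Finset.mem_insert, Finset.mem_filter] at hx
      rw [Finset.mem_filter]
      rcases hx with rfl | hx
      · exact ⟨hpB, hpE⟩
      · exact ⟨hx.1, hE₂ hx.2⟩
    have h2 := Finset.card_le_card h1
    rw [Finset.card_insert_of_notMem (by simp [hp₂]), hy', hy', hy₂, hm] at h2
    by_contra hlt
    have : r * q ≤ 1 * q := Nat.mul_le_mul_right _ (by omega)
    omega
  obtain ⟨s, hs⟩ : ∃ s, q = s + 4 := ⟨q - 4, by omega⟩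
  have hs2 : q - 2 = s + 2 := by omega
  rcases Nat.lt_or_ge r 3 with hr3 | hr3
  · have hr' : r = 2 := by omega
    rw [hr', hs2] at hcp
    have : 2 * q = 2 * (α p + β p) + s * β p + 2 := by rw [hcp]; ring
    have : s * 1 ≤ s * β p := Nat.mul_le_mul_left _ hβ1
    omega
  -- the number of secants through a vector of `B` in the plane
  have hβeq : ∀ x ∈ B, x ∈ E → x ≠ 0 → r * q = 2 * q + 4 + s * β x := by
    intro x hx hxE hx0
    have h1 := hcount x hx hxE hx0
    have h2 := hαβ x hx hxE hx0 hr3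
    rw [h1, hs2, show 2 * α x + (s + 2) * β x + 2 = 2 * (α x + β x) + s * β x + 2 by ring, h2]
    ring
  have hspos : 0 < s := by omega
  have hβconst : ∀ x ∈ B, x ∈ E → x ≠ 0 → β x = β p := by
    intro x hx hxE hx0
    have h1 := hβeq x hx hxE hx0
    rw [hβeq p hpB hpE hp0] at h1
    exact (Nat.eq_of_mul_eq_mul_left hspos (Nat.add_left_cancel h1)).symm
  -- incidences between the vectors of `B` in the plane and the secants
  have hdvd : (q - 1) ∣ (r * q - 1) * β p := by
    set S := (B.filter (· ∈ E)).erase 0 with hS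
    have hSmem : ∀ x, x ∈ S ↔ x ≠ 0 ∧ x ∈ B ∧ x ∈ E := by
      intro x
      simp [hS]
    set T : Finset (Submodule F W) :=
      (Set.toFinite {L : Submodule F W | finrank F L = 2 ∧ L ≤ E ∧ y L = q}).toFinset with hT
    have hTmem : ∀ L, L ∈ T ↔ finrank F L = 2 ∧ L ≤ E ∧ y L = q := by
      intro L
      simp [hT]
    have h1 := Finset.sum_card_bipartiteAbove_eq_sum_card_bipartiteBelow
      (fun (x : W) (L : Submodule F W) => x ∈ L) (s := S) (t := T)
    have h2 : ∀ x ∈ S, (T.bipartiteAbove (fun (x : W) (L : Submodule F W) => x ∈ L) x).card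
        = β p := by
      intro x hx
      rw [hSmem] at hx
      rw [← hβconst x hx.2.1 hx.2.2 hx.1, hβ, Finset.bipartiteAbove]
      congr 1
      ext L
      simp only [Finset.mem_filter, hTmem, mem_linesThrough]
      tauto
    have h3 : ∀ L ∈ T, (S.bipartiteBelow (fun (x : W) (L : Submodule F W) => x ∈ L) L).card
        = q - 1 := by
      intro L hL
      rw [hTmem] at hL
      rw [← hL.2.2, ← hy' L, ← Finset.card_erase_of_mem (s := B.filter (· ∈ L)) (a := 0)
        (by simp [h0]), Finset.bipartiteBelow]
      congr 1
      ext x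
      simp only [Finset.mem_filter, hSmem, Finset.mem_erase]
      constructor
      · rintro ⟨⟨h, h', -⟩, h4⟩
        exact ⟨h, h', h4⟩
      · rintro ⟨h, h', h4⟩
        exact ⟨⟨h, h', hL.2.1 h4⟩, h4⟩
    rw [Finset.sum_congr rfl h2, Finset.sum_congr rfl h3, Finset.sum_const, Finset.sum_const,
      smul_eq_mul, smul_eq_mul] at h1
    have h4 : S.card = r * q - 1 := by
      rw [hS, Finset.card_erase_of_mem (by simp [h0]), hy', hm]
    rw [← h4, h1]
    exact Dvd.intro_left _ rfl
  have hEq := hβeq p hpB hpE hp0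
  have hq1 : q - 1 = s + 3 := by omega
  rw [hq1] at hdvd
  have hfin : (s + 3) ∣ 2 → False := fun h => by
    have := Nat.le_of_dvd (by omega) h
    omega
  obtain hr3' | hr4 | hr5 : r = 3 ∨ r = 4 ∨ 5 ≤ r := by omega
  -- for `r = 3`, `β = 1` and `q - 1` divides `3 * q - 1`
  · rw [hr3'] at hEq hdvd
    have hb : β p = 1 := Nat.eq_of_mul_eq_mul_left hspos (by omega)
    rw [hb, mul_one, hs, show 3 * (s + 4) - 1 = 3 * (s + 3) + 2 by omega] at hdvd
    exact hfin ((Nat.dvd_add_right (Dvd.intro_left _ rfl)).1 hdvd)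
  -- for `r = 4`, `(q - 4) * β = 2 * q - 4`, which lies strictly between `2 * (q - 4)` and
  -- `3 * (q - 4)`
  · rw [hr4] at hEq
    rcases Nat.lt_or_ge (β p) 3 with h | h
    · have : s * β p ≤ s * 2 := Nat.mul_le_mul_left _ (by omega)
      omega
    · have : s * 3 ≤ s * β p := Nat.mul_le_mul_left _ h
      omega
  -- for `r ≥ 5`, all lines are secants, `β = q + 1`, `r = q - 1`, and `q - 1` divides
  -- `(q² - q - 1) (q + 1)`
  · have ha : α p = 0 := by
      rw [hα]
      simp only
      rw [Finset.card_eq_zero, Finset.filter_eq_empty_iff]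
      intro L hL h
      rw [mem_linesThrough] at hL
      have := hry L hL.1 hL.2.2
      omega
    have hb := hαβ p hpB hpE hp0 hr3
    rw [ha, zero_add] at hb
    rw [hb, hs, show r * (s + 4) = 2 * (s + 4) + 4 + s * (s + 4 + 1) by
      rw [← hs, hEq, hb]] at hdvd
    rw [show 2 * (s + 4) + 4 + s * (s + 4 + 1) - 1 = (s + 3) * (s + 3) + s + 2 by
      have : s * (s + 4 + 1) = s * s + 5 * s := by ring
      have : (s + 3) * (s + 3) = s * s + 6 * s + 9 := by ring
      omega] at hdvd
    -- modulo `q - 1` the product is `(-1) * 2`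
    have h2 : ((s + 3) * (s + 3) + s + 2) * (s + 4 + 1) + 2 =
        (s + 3) * ((s + 3) * (s + 5) + (s + 4)) := by ring
    have h3 : (s + 3) ∣ ((s + 3) * (s + 3) + s + 2) * (s + 4 + 1) + 2 := h2 ▸ Dvd.intro _ rfl
    exact hfin ((Nat.dvd_add_right hdvd).1 h3)

end

/-! ### From directions to a scattered subgroup -/

section

variable {F W : Type*} [Field F] [AddCommGroup W] [Module F W]

lemma finrank_map_mkQ_add {L E : Submodule F W} [FiniteDimensional F W] (hLE : L ≤ E) :
    finrank F (E.map L.mkQ) + finrank F L = finrank F E := by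
  have h := (L.mkQ.domRestrict E).finrank_range_add_finrank_ker
  rw [LinearMap.range_domRestrict, LinearMap.ker_domRestrict, Submodule.ker_mkQ] at h
  rw [← (Submodule.submoduleOfEquivOfLe hLE).finrank_eq]
  exact h

/-- The number of points of `A` in the translate of the subspace `Y` through `a`. -/
noncomputable def cnt (A : Set W) (a : W) (Y : Submodule F W) : ℕ := {x | x ∈ A ∧ x - a ∈ Y}.ncard

variable (F) in
/-- What the hypotheses on the directions say about the affine set `A` itself: no three of its
points are collinear, each direction determined by `A` occurs at each point of `A`, and the number
of points of `A` in an affine plane that meets `A` is `1`, `2`, `4` or `q` and depends only on the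
direction of the plane. -/
structure DirectionGeometry (k : ℕ) (A : Set W) : Prop where
  two_le : 2 ≤ k
  le_card : 16 ≤ Nat.card F
  finrank_eq : finrank F W = 2 * k
  ncard_eq : A.ncard = Nat.card F ^ k
  add_self : ∀ x : W, x + x = 0
  collinear : ∀ a ∈ A, ∀ b ∈ A, ∀ c ∈ A, b ≠ a → c - a ∈ Submodule.span F {b - a} → c = a ∨ c = b
  exists_parallel : ∀ a ∈ A, ∀ b ∈ A, ∀ c ∈ A, b ≠ a →
    ∃ d ∈ A, d ≠ c ∧ d - c ∈ Submodule.span F {b - a}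
  cnt_eq : ∀ L : Submodule F W, finrank F L = 2 → ∀ a ∈ A, ∀ b ∈ A, cnt A a L = cnt A b L
  cnt_cases : ∀ L : Submodule F W, finrank F L = 2 → ∀ a ∈ A,
    cnt A a L = 1 ∨ cnt A a L = 2 ∨ cnt A a L = 4 ∨ cnt A a L = Nat.card F

namespace DirectionGeometry

variable {k : ℕ} {A : Set W}

lemma finite (G : DirectionGeometry F k A) : Finite F :=
  Nat.finite_of_card_ne_zero (by have := G.le_card; omega)

lemma finiteDimensional (G : DirectionGeometry F k A) : FiniteDimensional F W :=
  Module.finite_of_finrank_pos (by rw [G.finrank_eq]; have := G.two_le; omega)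

lemma finite_space (G : DirectionGeometry F k A) : Finite W := by
  have := G.finite
  have := G.finiteDimensional
  exact Module.finite_of_finite F

/-- Four points in a plane on three directions form a parallelogram. -/
lemma add_sub_mem_of_cnt_eq_four (G : DirectionGeometry F k A) {a b c : W} (ha : a ∈ A)
    (hb : b ∈ A) (hc : c ∈ A) (hba : b ≠ a) (hcb : c - a ∉ Submodule.span F {b - a})
    (h4 : cnt A a (Submodule.span F {b - a, c - a}) = 4) : b + c - a ∈ A := by
  classical
  have := G.finite_space
  have hba0 : b - a ≠ 0 := sub_ne_zero.2 hba
  have hca0 : c - a ≠ 0 := fun h => hcb (h ▸ Submodule.zero_mem _)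
  have hca : c ≠ a := sub_ne_zero.1 hca0
  have hcb' : c ≠ b := fun h => hcb (h ▸ Submodule.mem_span_singleton_self _)
  have hbc : b - a ∉ Submodule.span F {c - a} := fun h => by
    rcases G.collinear a ha c hc b hb hca h with h | h
    · exact hba h
    · exact hcb' h.symm
  set L := Submodule.span F {b - a, c - a} with hL
  have hbL : b - a ∈ L := Submodule.subset_span (by simp)
  have hcL : c - a ∈ L := Submodule.subset_span (by simp)
  obtain ⟨d, hd, hdb, hdb'⟩ := G.exists_parallel a ha c hc b hb hca
  obtain ⟨d', hd', hdc, hdc'⟩ := G.exists_parallel a ha b hb c hc hba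
  have hdL : d - a ∈ L := by
    have h1 : d - b ∈ L := (Submodule.span_singleton_le_iff_mem _ _).2 hcL hdb'
    have := L.add_mem h1 hbL
    rwa [sub_add_sub_cancel] at this
  have hdL' : d' - a ∈ L := by
    have h1 : d' - c ∈ L := (Submodule.span_singleton_le_iff_mem _ _).2 hbL hdc'
    have := L.add_mem h1 hcL
    rwa [sub_add_sub_cancel] at this
  have hda : d ≠ a := by
    rintro rfl
    exact hbc (by simpa using Submodule.neg_mem _ hdb')
  have hda' : d' ≠ a := by
    rintro rfl
    exact hcb (by simpa using Submodule.neg_mem _ hdc')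
  have hdc0 : d ≠ c := by
    rintro rfl
    refine hbc ?_
    have := Submodule.sub_mem _ (Submodule.mem_span_singleton_self (R := F) (d - a)) hdb'
    simpa using this
  have hdb0 : d' ≠ b := by
    rintro rfl
    refine hcb ?_
    have := Submodule.sub_mem _ (Submodule.mem_span_singleton_self (R := F) (d' - a)) hdc'
    simpa using this
  -- both `d` and `d'` are the fourth point of the plane
  have hdd : d = d' := by
    by_contra hne
    have h5 : ({a, b, c, d, d'} : Finset W).card = 5 := by
      rw [Finset.card_insert_of_notMem, Finset.card_insert_of_notMem, Finset.card_insert_of_notMem,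
        Finset.card_pair hne]
      · simp [Ne.symm hdc0, Ne.symm hdc]
      · simp [Ne.symm hcb', Ne.symm hdb, Ne.symm hdb0]
      · simp [Ne.symm hba, Ne.symm hca, Ne.symm hda, Ne.symm hda']
    have h6 : (({a, b, c, d, d'} : Finset W) : Set W) ⊆ {x | x ∈ A ∧ x - a ∈ L} := by
      intro x hx
      simp only [Finset.coe_insert, Finset.coe_singleton, Set.mem_insert_iff,
        Set.mem_singleton_iff] at hx
      rcases hx with rfl | rfl | rfl | rfl | rfl
      · exact ⟨ha, by simp⟩
      · exact ⟨hb, hbL⟩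
      · exact ⟨hc, hcL⟩
      · exact ⟨hd, hdL⟩
      · exact ⟨hd', hdL'⟩
    have h7 := Set.ncard_le_ncard h6
    rw [Set.ncard_coe_finset, h5] at h7
    unfold cnt at h4
    omega
  subst hdd
  obtain ⟨l, hl⟩ := Submodule.mem_span_singleton.1 hdb'
  obtain ⟨m, hm⟩ := Submodule.mem_span_singleton.1 hdc'
  have h1 : (l - 1) • (c - a) = (m - 1) • (b - a) := by
    rw [sub_smul, sub_smul, hl, hm, one_smul, one_smul]
    abel
  have hl1 : l = 1 := by
    by_contra hne
    refine hcb (Submodule.mem_span_singleton.2 ⟨(l - 1)⁻¹ * (m - 1), ?_⟩)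
    rw [mul_smul, ← h1, smul_smul, inv_mul_cancel₀ (sub_ne_zero.2 hne), one_smul]
  rw [hl1, one_smul] at hl
  have : b + c - a = d := by rw [add_sub_assoc, hl, add_sub_cancel]
  rwa [this]

/-- The section of `A` by a translate of `E` splits into its sections by cosets of `L`, all of the
same size if nonempty. -/
lemma exists_cnt_eq_mul (G : DirectionGeometry F k A) {a : W} (ha : a ∈ A) {L E : Submodule F W}
    (hL : finrank F L = 2) (hE : finrank F E = 3) (hLE : L ≤ E) :
    ∃ r ≤ Nat.card F, cnt A a E = r * cnt A a L := by
  classical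
  have := G.finite_space
  set S := (Set.toFinite {x | x ∈ A ∧ x - a ∈ E}).toFinset with hS
  have hSm : ∀ x, x ∈ S ↔ x ∈ A ∧ x - a ∈ E := fun x => by simp [hS]
  have hSc : cnt A a E = S.card := Set.ncard_eq_toFinset_card _ _
  refine ⟨(S.image fun x => L.mkQ (x - a)).card, ?_, ?_⟩
  · have h1 := finrank_map_mkQ_add hLE
    have h2 : finrank F (E.map L.mkQ) = 1 := by omega
    have h3 : (E.map L.mkQ : Set (W ⧸ L)).ncard = Nat.card F := by
      have := Module.natCard_eq_pow_finrank (K := F) (V := E.map L.mkQ)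
      rw [h2, pow_one] at this
      exact this
    rw [← h3, ← Set.ncard_coe_finset]
    have : Finite (W ⧸ L) := Finite.of_surjective L.mkQ L.mkQ_surjective
    refine Set.ncard_le_ncard ?_
    intro z hz
    rw [Finset.coe_image] at hz
    obtain ⟨x, hx, rfl⟩ := hz
    exact Submodule.mem_map_of_mem ((hSm x).1 hx).2
  · rw [hSc, Finset.card_eq_sum_card_image (fun x => L.mkQ (x - a)) S, ← smul_eq_mul,
      ← Finset.sum_const]
    refine Finset.sum_congr rfl fun z hz => ?_
    obtain ⟨x₀, hx₀, rfl⟩ := Finset.mem_image.1 hz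
    rw [hSm] at hx₀
    rw [G.cnt_eq L hL a ha x₀ hx₀.1, cnt, ← Set.ncard_coe_finset]
    congr 1
    ext x
    simp only [Finset.coe_filter, Set.mem_ofPred_eq, hSm]
    have h1 : L.mkQ (x - a) = L.mkQ (x₀ - a) ↔ x - x₀ ∈ L := by
      rw [← sub_eq_zero, ← map_sub, sub_sub_sub_cancel_right, Submodule.mkQ_apply,
        Submodule.Quotient.mk_eq_zero]
    rw [h1]
    constructor
    · rintro ⟨⟨h, -⟩, h'⟩
      exact ⟨h, h'⟩
    · rintro ⟨h, h'⟩
      refine ⟨⟨h, ?_⟩, h'⟩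
      have := E.add_mem (hLE h') hx₀.2
      rwa [sub_add_sub_cancel] at this

lemma eq_of_cnt_eq_card (G : DirectionGeometry F k A) {a : W} (ha : a ∈ A) {L M : Submodule F W}
    (hL : finrank F L = 2) (hM : finrank F M = 2) (hLa : cnt A a L = Nat.card F)
    (hMa : cnt A a M = Nat.card F) {z : W} (hz0 : z ≠ 0) (hzL : z ∈ L) (hzM : z ∈ M) : L = M := by
  classical
  have := G.finite
  have := G.finite_space
  have : Fintype W := Fintype.ofFinite W
  by_contra hne
  have h1 : finrank F ↥(L ⊓ M) ≠ 0 := by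
    rw [Ne, Submodule.finrank_eq_zero]
    intro h
    exact hz0 ((Submodule.mem_bot F).1 (h ▸ ⟨hzL, hzM⟩))
  have h2 : finrank F ↥(L ⊓ M) < 2 := by
    rw [← hM]
    refine Submodule.finrank_lt_finrank_of_lt (lt_of_le_of_ne inf_le_right fun h => hne ?_)
    exact (Submodule.eq_of_le_of_finrank_eq (inf_eq_right.1 h) (by rw [hL, hM])).symm
  have h3 := Submodule.finrank_sup_add_finrank_inf_eq L M
  have hE : finrank F ↥(L ⊔ M) = 3 := by omega
  refine false_of_two_secants (F := F) (Finset.univ.filter fun v => v + a ∈ A) G.le_card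
    (by simpa using ha) ?_ (cnt A a) ?_ (fun L hL => G.cnt_cases L hL a ha) hE
    (fun L hL hLE => G.exists_cnt_eq_mul ha hL hE hLE) hL hM le_sup_left le_sup_right hLa hMa hne
  · intro p hp x hx hp0 hxp
    simp only [Finset.mem_filter, Finset.mem_univ, true_and] at hp hx
    rcases G.collinear a ha (p + a) hp (x + a) hx (by simpa using hp0) (by simpa using hxp)
      with h | h
    · left
      simpa using h
    · right
      simpa using h
  · intro Y s hs
    rw [cnt, ← Set.ncard_coe_finset]
    refine Set.ncard_congr (fun x _ => x + a) ?_ (fun x y _ _ h => by simpa using h) ?_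
    · intro x hx
      have := (hs x).1 hx
      simpa using this
    · intro x hx
      exact ⟨x - a, (hs _).2 (by simpa using hx), by simp⟩

/-- Two points of `A` in a plane with `q` points and a point of `A` off that plane span a plane that
has only four points of `A`, because two lines with `q - 1` directions are disjoint. -/
lemma add_sub_mem_of_notMem (G : DirectionGeometry F k A) {L : Submodule F W}
    (hL : finrank F L = 2) {x y z : W} (hx : x ∈ A) (hy : y ∈ A) (hz : z ∈ A)
    (hxL : cnt A x L = Nat.card F) (hyx : y ≠ x) (hyL : y - x ∈ L) (hzL : z - x ∉ L) :
    y + z - x ∈ A := by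
  classical
  have := G.finite_space
  have hyx0 : y - x ≠ 0 := sub_ne_zero.2 hyx
  have hzy : z - x ∉ Submodule.span F {y - x} := fun h =>
    hzL ((Submodule.span_singleton_le_iff_mem _ _).2 hyL h)
  have h2 := finrank_span_pair_eq_two hyx0 hzy
  refine G.add_sub_mem_of_cnt_eq_four hx hy hz hyx hzy ?_
  set M := Submodule.span F {y - x, z - x} with hM
  have hyM : y - x ∈ M := Submodule.subset_span (by simp)
  have hzM : z - x ∈ M := Submodule.subset_span (by simp)
  have h3 : 3 ≤ cnt A x M := by
    have h3 : ({x, y, z} : Finset W).card = 3 := Finset.card_eq_three.2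
      ⟨x, y, z, hyx.symm, fun h => hzL (by rw [← h, sub_self]; exact L.zero_mem),
        fun h => hzL (h ▸ hyL), rfl⟩
    rw [← h3, ← Set.ncard_coe_finset]
    refine Set.ncard_le_ncard fun t ht => ?_
    simp only [Finset.coe_insert, Finset.coe_singleton, Set.mem_insert_iff,
      Set.mem_singleton_iff] at ht
    rcases ht with rfl | rfl | rfl
    · exact ⟨hx, by simp⟩
    · exact ⟨hy, hyM⟩
    · exact ⟨hz, hzM⟩
  rcases G.cnt_cases M h2 x hx with h | h | h | h
  · omega
  · omega
  · exact h
  · exact absurd (G.eq_of_cnt_eq_card hx hL h2 hxL h hyx0 hyL hyM ▸ hzM) hzL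

lemma add_sub_mem (G : DirectionGeometry F k A) {a b c : W} (ha : a ∈ A) (hb : b ∈ A)
    (hc : c ∈ A) : b + c - a ∈ A := by
  classical
  have := G.finite_space
  have hsub : ∀ x y : W, x - y = x + y := fun x y => by
    rw [sub_eq_add_neg, neg_eq_of_add_eq_zero_left (G.add_self y)]
  by_cases hba : b = a
  · subst hba
    simpa using hc
  by_cases hcb : c - a ∈ Submodule.span F {b - a}
  · rcases G.collinear a ha b hb c hc hba hcb with rfl | rfl
    · simpa using hb
    · rw [G.add_self, hsub, zero_add]
      exact ha
  have hba0 : b - a ≠ 0 := sub_ne_zero.2 hba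
  have h2 := finrank_span_pair_eq_two hba0 hcb
  set L := Submodule.span F {b - a, c - a} with hLdef
  have hbL : b - a ∈ L := Submodule.subset_span (by simp)
  have hcL : c - a ∈ L := Submodule.subset_span (by simp)
  have hca : c ≠ a := fun h => hcb (by rw [h, sub_self]; exact Submodule.zero_mem _)
  have hcb' : c ≠ b := fun h => hcb (h ▸ Submodule.mem_span_singleton_self _)
  have h3 : 3 ≤ cnt A a L := by
    have h3 : ({a, b, c} : Finset W).card = 3 := Finset.card_eq_three.2
      ⟨a, b, c, Ne.symm hba, hca.symm, hcb'.symm, rfl⟩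
    rw [← h3, ← Set.ncard_coe_finset]
    refine Set.ncard_le_ncard fun t ht => ?_
    simp only [Finset.coe_insert, Finset.coe_singleton, Set.mem_insert_iff,
      Set.mem_singleton_iff] at ht
    rcases ht with rfl | rfl | rfl
    · exact ⟨ha, by simp⟩
    · exact ⟨hb, hbL⟩
    · exact ⟨hc, hcL⟩
  rcases G.cnt_cases L h2 a ha with h | h | h | hq
  · omega
  · omega
  · exact G.add_sub_mem_of_cnt_eq_four ha hb hc hba hcb h
  -- carry `b` and `c` along to the plane through a point `d` off the plane of `a`, `b`, `c`, and
  -- come back with the translation that takes `b + d - a` to `a`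
  obtain ⟨d, hd, hdL⟩ : ∃ d ∈ A, d - a ∉ L := by
    by_contra hno
    push Not at hno
    have h4 : A ⊆ {x | x ∈ A ∧ x - a ∈ L} := fun x hx => ⟨hx, hno x hx⟩
    have h5 := Set.ncard_le_ncard h4
    rw [G.ncard_eq] at h5
    unfold cnt at hq
    rw [hq] at h5
    have h6 : Nat.card F ^ 1 < Nat.card F ^ k :=
      Nat.pow_lt_pow_right (by have := G.le_card; omega) (by have := G.two_le; omega)
    rw [pow_one] at h6
    omega
  have hbd := G.add_sub_mem_of_notMem h2 ha hb hd hq hba hbL hdL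
  have hcd := G.add_sub_mem_of_notMem h2 ha hc hd hq hca hcL hdL
  have h4 := G.add_sub_mem_of_notMem h2 (x := b + d - a) (y := c + d - a) (z := a) hbd hcd ha
    (by rw [G.cnt_eq L h2 _ hbd a ha, hq]) (fun h => hcb' (by simpa using h))
    (by
      have := L.sub_mem hcL hbL
      rw [sub_sub_sub_cancel_right] at this
      rwa [sub_sub_sub_cancel_right, add_sub_add_right_eq_sub])
    (fun h => by
      refine hdL ?_
      have h5 := L.neg_mem (L.add_mem h hbL)
      have : -(a - (b + d - a) + (b - a)) = d - a := by abel
      rwa [this] at h5)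
  have h5 : c + d - a + a - (b + d - a) = b + c - a := by
    have : c + d - a + a - (b + d - a) = c - b + a := by abel
    rw [this, hsub c b, hsub (b + c) a, add_comm c b]
  rwa [h5] at h4

/-- The translate of `A` that takes its point `a` to the origin, a subgroup. -/
def translate (G : DirectionGeometry F k A) {a : W} (ha : a ∈ A) : AddSubgroup W where
  carrier := {v | v + a ∈ A}
  zero_mem' := by simpa using ha
  add_mem' := by
    intro x y hx hy
    have h := G.add_sub_mem ha hx hy
    have h' : x + a + (y + a) - a = x + y + a := by abel
    rwa [h'] at h
  neg_mem' := by
    intro x hx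
    rwa [Set.mem_ofPred_eq, neg_eq_of_add_eq_zero_left (G.add_self x)]

lemma mem_translate {G : DirectionGeometry F k A} {a : W} {ha : a ∈ A} {v : W} :
    v ∈ G.translate ha ↔ v + a ∈ A := Iff.rfl

lemma card_sect_translate (G : DirectionGeometry F k A) {a : W} (ha : a ∈ A)
    (Y : Submodule F W) : Nat.card (sect (G.translate ha) Y) = cnt A a Y := by
  refine Set.ncard_congr (s := (sect (G.translate ha) Y : Set W)) (fun x _ => x + a) ?_
    (fun x y _ _ h => by simpa using h) ?_
  · intro x hx
    exact ⟨hx.1, by simpa using hx.2⟩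
  · intro x hx
    exact ⟨x - a, ⟨mem_translate.2 (by simpa using hx.1), hx.2⟩, by simp⟩

lemma secantGeometry (G : DirectionGeometry F k A) {a : W} (ha : a ∈ A) :
    SecantGeometry F k (G.translate ha) where
  two_le := G.two_le
  le_card := G.le_card
  finrank_eq := G.finrank_eq
  card_eq := by
    have h := G.card_sect_translate ha (⊤ : Submodule F W)
    have h1 : sect (G.translate ha) (⊤ : Submodule F W) = G.translate ha := by
      ext x
      simp
    rw [h1] at h
    rw [h, cnt, ← G.ncard_eq]
    simp
  scattered := by
    intro u hu hu0 c hc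
    rcases G.collinear a ha (u + a) hu (c • u + a) hc (by simpa using hu0)
      (by simpa using Submodule.smul_mem _ c (Submodule.mem_span_singleton_self u)) with h | h
    · left
      have : c • u = 0 := by simpa using h
      exact (smul_eq_zero.1 this).resolve_right hu0
    · right
      have : (c - 1) • u = 0 := by
        rw [sub_smul, one_smul, sub_eq_zero]
        simpa using h
      exact sub_eq_zero.1 ((smul_eq_zero.1 this).resolve_right hu0)
  card_sect := by
    intro L hL
    rw [G.card_sect_translate ha]
    have := G.cnt_cases L hL a ha
    omega
  disjoint := by
    intro L M hL hM hne
    rw [Submodule.disjoint_def]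
    intro z hzL hzM
    by_contra hz0
    rw [IsSecant, G.card_sect_translate ha] at hL hM
    exact hne (G.eq_of_cnt_eq_card ha hL.1 hM.1 hL.2 hM.2 hz0 hzL hzM)

end DirectionGeometry

end

/-! ### Directions of an affine set -/

section

variable {F W : Type*} [Field F] [AddCommGroup W] [Module F W]

lemma mk_mem_points {v : W} (hv : v ≠ 0) {L : Submodule F W} :
    Projectivization.mk F v hv ∈ points L ↔ v ∈ L := by
  rw [points, Set.mem_ofPred_eq, Projectivization.submodule_mk, Submodule.span_singleton_le_iff_mem]

lemma mk_eq_mk_iff_mem_span {v w : W} (hv : v ≠ 0) (hw : w ≠ 0) :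
    Projectivization.mk F v hv = Projectivization.mk F w hw ↔ v ∈ Submodule.span F {w} := by
  rw [Projectivization.mk_eq_mk_iff', Submodule.mem_span_singleton]

variable (F) in
/-- The points at infinity `⟨b - a⟩` of the lines that join two points `a`, `b` of an affine
set `A`. -/
def affineDirections (A : Set W) : Set (ℙ F W) :=
  {P | ∃ a ∈ A, ∃ b ∈ A, ∃ h : b - a ≠ 0, P = Projectivization.mk F (b - a) h}

lemma lt_ncard_points [Finite F] {L : Submodule F W} (hL : finrank F L = 2) [Finite W] :
    Nat.card F < (points L).ncard := by
  have h1 := Projectivization.card_of_finrank_two F L hL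
  have h2 : (Set.range (Projectivization.map L.subtype L.injective_subtype)).ncard =
      Nat.card F + 1 := by
    rw [← h1, ← Set.image_univ, Set.InjOn.ncard_image, Set.ncard_univ]
    exact (Projectivization.map_injective _ _).injOn
  have h3 : Set.range (Projectivization.map L.subtype L.injective_subtype) ⊆ points L := by
    rintro _ ⟨P, rfl⟩
    induction P using Projectivization.ind with
    | h v hv =>
      rw [Projectivization.map_mk, mk_mem_points]
      exact v.2
  have h4 := Set.ncard_le_ncard h3
  omega

/-- Lines through an undetermined direction have at most one point in `A`, hence a plane with
an undetermined direction has at most `q`. -/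
lemma cnt_le_card [Finite F] [Finite W] {A : Set W} {L : Submodule F W}
    (hL : finrank F L = 2) (a : W)
    (hD : (affineDirections F A ∩ points L).ncard ≤ Nat.card F) :
    cnt A a L ≤ Nat.card F := by
  obtain ⟨P, hPL, hPD⟩ : ∃ P ∈ points L, P ∉ affineDirections F A := by
    by_contra h
    push Not at h
    have h1 := lt_ncard_points hL
    have h2 := Set.ncard_le_ncard
      (show points L ⊆ affineDirections F A ∩ points L from fun P hP => ⟨h P hP, hP⟩)
    omega
  induction P using Projectivization.ind with
  | h z hz =>
    rw [mk_mem_points] at hPL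
    set Z := Submodule.span F {z} with hZ
    have hZL : Z ≤ L := (Submodule.span_singleton_le_iff_mem _ _).2 hPL
    have h1 := finrank_map_mkQ_add hZL
    rw [hL, hZ, finrank_span_singleton hz, ← hZ] at h1
    have h2 : finrank F (L.map Z.mkQ) = 1 := by omega
    have h3 : (L.map Z.mkQ : Set (W ⧸ Z)).ncard = Nat.card F := by
      have := Module.natCard_eq_pow_finrank (K := F) (V := L.map Z.mkQ)
      rw [h2, pow_one] at this
      exact this
    rw [← h3]
    have : Finite (W ⧸ Z) := Finite.of_surjective Z.mkQ Z.mkQ_surjective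
    refine Set.ncard_le_ncard_of_injOn (fun x => Z.mkQ (x - a))
      (fun x hx => Submodule.mem_map_of_mem hx.2) ?_
    intro x hx x' hx' h
    have h4 : x' - x ∈ Z := by
      have h5 : Z.mkQ (x - a) = Z.mkQ (x' - a) := h
      rw [eq_comm, ← sub_eq_zero, ← map_sub, sub_sub_sub_cancel_right, Submodule.mkQ_apply,
        Submodule.Quotient.mk_eq_zero] at h5
      exact h5
    by_contra hne
    have h5 : x' - x ≠ 0 := sub_ne_zero.2 (Ne.symm hne)
    refine hPD ⟨x, hx.1, x', hx'.1, h5, ?_⟩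
    rw [eq_comm, mk_eq_mk_iff_mem_span]
    exact h4

/-- A plane through three collinear points of `A` and a further point `x` of `A` has at least four
directions: that of the line and those of the lines from `x` to the three points. -/
lemma four_le_ncard_of_collinear [Finite W] {A : Set W} {a b c x : W} (ha : a ∈ A) (hb : b ∈ A)
    (hc : c ∈ A) (hab : a ≠ b) (hac : a ≠ c) (hbc : b ≠ c)
    (hcb : c - a ∈ Submodule.span F {b - a}) (hx : x ∈ A)
    (hxZ : x - a ∉ Submodule.span F {b - a}) :
    4 ≤ (affineDirections F A ∩ points (Submodule.span F {b - a, x - a})).ncard := by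
  classical
  have hba0 : b - a ≠ 0 := sub_ne_zero.2 hab.symm
  set D := affineDirections F A with hDdef
  set e := b - a with he
  set Z := Submodule.span F {e} with hZ
  have heZ : e ∈ Z := Submodule.mem_span_singleton_self e
  set T := {x | x ∈ A ∧ x - a ∈ Z} with hT
  set L := Submodule.span F {e, x - a} with hL
  have heL : e ∈ L := Submodule.subset_span (by simp)
  have hxL : x - a ∈ L := Submodule.subset_span (by simp)
  have hZL : Z ≤ L := (Submodule.span_singleton_le_iff_mem _ _).2 heL
  have hTx : ∀ y ∈ T, x - y ∉ Z := fun y hy h => hxZ (by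
    have := Z.add_mem h hy.2
    rwa [sub_add_sub_cancel] at this)
  have hTx0 : ∀ y ∈ T, x - y ≠ 0 := fun y hy h => hTx y hy (h ▸ Z.zero_mem)
  have haT : a ∈ T := ⟨ha, by simp⟩
  have hbT : b ∈ T := ⟨hb, heZ⟩
  have hcT : c ∈ T := ⟨hc, hcb⟩
  have hTne : ∀ y (hy : y ∈ T) z (hz : z ∈ T), y ≠ z →
      Projectivization.mk F (x - y) (hTx0 y hy) ≠ Projectivization.mk F (x - z) (hTx0 z hz) := by
    intro y hy z hz hyz h
    rw [mk_eq_mk_iff_mem_span] at h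
    obtain ⟨l, hl⟩ := Submodule.mem_span_singleton.1 h
    have h5 : (1 - l) • (x - z) ∈ Z := by
      have h6 := Z.sub_mem hy.2 hz.2
      rw [sub_smul, one_smul, hl]
      have : x - z - (x - y) = y - a - (z - a) := by abel
      rwa [this]
    have h6 : 1 - l = 0 := by
      by_contra h7
      exact hTx z hz ((Z.smul_mem_iff h7).1 h5)
    have h7 : l = 1 := (sub_eq_zero.1 h6).symm
    rw [h7, one_smul] at hl
    exact hyz (sub_right_injective hl).symm
  have heT : ∀ y (hy : y ∈ T),
      Projectivization.mk F e hba0 ≠ Projectivization.mk F (x - y) (hTx0 y hy) := by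
    intro y hy h
    rw [eq_comm, mk_eq_mk_iff_mem_span] at h
    exact hTx y hy h
  have hTD : ∀ y (hy : y ∈ T), Projectivization.mk F (x - y) (hTx0 y hy) ∈ D ∩ points L := by
    intro y hy
    refine ⟨⟨y, hy.1, x, hx, hTx0 y hy, rfl⟩, ?_⟩
    rw [mk_mem_points]
    have := L.sub_mem hxL (hZL hy.2)
    rwa [sub_sub_sub_cancel_right] at this
  have h4 : ({Projectivization.mk F e hba0, Projectivization.mk F (x - a) (hTx0 a haT),
      Projectivization.mk F (x - b) (hTx0 b hbT), Projectivization.mk F (x - c) (hTx0 c hcT)} :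
      Finset (ℙ F W)).card = 4 := by
    rw [Finset.card_insert_of_notMem, Finset.card_insert_of_notMem, Finset.card_pair]
    · exact hTne b hbT c hcT hbc
    · simp only [Finset.mem_insert, Finset.mem_singleton, not_or]
      exact ⟨hTne a haT b hbT hab, hTne a haT c hcT hac⟩
    · simp only [Finset.mem_insert, Finset.mem_singleton, not_or]
      exact ⟨heT a haT, heT b hbT, heT c hcT⟩
  rw [← h4, ← Set.ncard_coe_finset]
  refine Set.ncard_le_ncard fun P hP => ?_
  simp only [Finset.coe_insert, Finset.coe_singleton, Set.mem_insert_iff,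
    Set.mem_singleton_iff] at hP
  rcases hP with rfl | rfl | rfl | rfl
  · exact ⟨⟨a, ha, b, hb, hba0, rfl⟩, (mk_mem_points hba0).2 heL⟩
  · exact hTD a haT
  · exact hTD b hbT
  · exact hTD c hcT

/-- No three points of `A` are collinear: if the line `ℓ` joining `a` and `b` had `t ≥ 3` points
in `A`, then a plane through `ℓ` with a further point of `A` would have at least four directions,
hence exactly `q - 1`, and at most `q - t` points of `A` off `ℓ`. The `m` planes of this kind would
yield `q ^ k - t ≤ m (q - t)` and `m (q - 2) ≤ q ^ k - 2`, which contradict each other. -/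
lemma eq_or_eq_of_mem_span [Finite F] [Finite W] {A : Set W} {k : ℕ} (hq : 16 ≤ Nat.card F)
    (hk : 2 ≤ k) (hA : A.ncard = Nat.card F ^ k)
    (hD : (affineDirections F A).ncard = Nat.card F ^ k - 1)
    (hlines : ∀ L : Submodule F W, finrank F L = 2 →
      (affineDirections F A ∩ points L).ncard = 0 ∨ (affineDirections F A ∩ points L).ncard = 1 ∨
      (affineDirections F A ∩ points L).ncard = 3 ∨
      (affineDirections F A ∩ points L).ncard = Nat.card F - 1)
    {a b c : W} (ha : a ∈ A) (hb : b ∈ A) (hc : c ∈ A) (hba : b ≠ a)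
    (hcb : c - a ∈ Submodule.span F {b - a}) : c = a ∨ c = b := by
  classical
  by_contra! hcon
  obtain ⟨hca, hcb'⟩ := hcon
  have hba0 : b - a ≠ 0 := sub_ne_zero.2 hba
  set D := affineDirections F A with hDdef
  set e := b - a with he
  set q := Nat.card F with hqdef
  set Z := Submodule.span F {e} with hZ
  have heZ : e ∈ Z := Submodule.mem_span_singleton_self e
  set T := {x | x ∈ A ∧ x - a ∈ Z} with hT
  have hTA : T ⊆ A := fun x hx => hx.1
  have ht : 3 ≤ T.ncard := by
    have h3 : ({a, b, c} : Finset W).card = 3 := Finset.card_eq_three.2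
      ⟨a, b, c, hba.symm, hca.symm, hcb'.symm, rfl⟩
    rw [← h3, ← Set.ncard_coe_finset]
    refine Set.ncard_le_ncard fun x hx => ?_
    simp only [Finset.coe_insert, Finset.coe_singleton, Set.mem_insert_iff,
      Set.mem_singleton_iff] at hx
    rcases hx with rfl | rfl | rfl
    · exact ⟨ha, by simp⟩
    · exact ⟨hb, heZ⟩
    · exact ⟨hc, hcb⟩
  -- the directions of the planes through the line that have a further point of `A`
  have hplane : ∀ x ∈ A, x ∉ T → finrank F (Submodule.span F {e, x - a}) = 2 ∧
      (D ∩ points (Submodule.span F {e, x - a})).ncard = q - 1 := by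
    intro x hx hxT
    have hxZ : x - a ∉ Z := fun h => hxT ⟨hx, h⟩
    have h2 := finrank_span_pair_eq_two hba0 hxZ
    have h3 := four_le_ncard_of_collinear ha hb hc hba.symm hca.symm hcb'.symm hcb hx hxZ
    rw [← hDdef, ← he] at h3
    refine ⟨h2, ?_⟩
    rcases hlines _ h2 with h | h | h | h
    · omega
    · omega
    · omega
    · exact h
  set S := (Set.toFinite (A \ T)).toFinset with hS
  have hSm : ∀ x, x ∈ S ↔ x ∈ A ∧ x ∉ T := fun x => by simp [hS]
  have hScard : S.card + T.ncard = q ^ k := by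
    rw [hS, ← Set.ncard_eq_toFinset_card, ← hA]
    exact Set.ncard_sdiff_add_ncard_of_subset hTA
  set Λ := S.image fun x => Submodule.span F {e, x - a} with hΛ
  have hTL : ∀ x ∈ S, T.ncard ≤ q ∧
      (S.filter fun x' => Submodule.span F {e, x' - a} = Submodule.span F {e, x - a}).card ≤
        q - T.ncard := by
    intro x hx
    rw [hSm] at hx
    obtain ⟨h2, h3⟩ := hplane x hx.1 hx.2
    set L := Submodule.span F {e, x - a} with hL
    have heL : e ∈ L := Submodule.subset_span (by simp)
    have hZL : Z ≤ L := (Submodule.span_singleton_le_iff_mem _ _).2 heL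
    have h4 : cnt A a L ≤ q := cnt_le_card h2 a (by rw [← hDdef]; omega)
    have h5 : T ⊆ {x | x ∈ A ∧ x - a ∈ L} := fun y hy => ⟨hy.1, hZL hy.2⟩
    have h6 : ((S.filter fun x' => Submodule.span F {e, x' - a} = L).card) + T.ncard ≤ q := by
      refine le_trans ?_ h4
      rw [cnt, ← Set.ncard_sdiff_add_ncard_of_subset h5, ← Set.ncard_coe_finset]
      refine Nat.add_le_add_right (Set.ncard_le_ncard fun y hy => ?_) _
      rw [Finset.mem_coe, Finset.mem_filter, hSm] at hy
      exact ⟨⟨hy.1.1, hy.2 ▸ Submodule.subset_span (by simp)⟩, hy.1.2⟩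
    omega
  have hqk : q ^ 1 < q ^ k := Nat.pow_lt_pow_right (by omega) (by omega)
  rw [pow_one] at hqk
  have hSne : S.Nonempty := by
    by_contra h
    rw [Finset.not_nonempty_iff_eq_empty] at h
    -- then `A` is contained in the line, which has only `q` points
    rw [h, Finset.card_empty, zero_add] at hScard
    have h1 : T.ncard ≤ (Z : Set W).ncard :=
      Set.ncard_le_ncard_of_injOn (fun x => x - a) (fun x hx => hx.2)
        (fun x _ y _ hxy => sub_left_injective hxy)
    have h2 : (Z : Set W).ncard = q := by
      have := Module.natCard_eq_pow_finrank (K := F) (V := Z)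
      rw [finrank_span_singleton hba0, pow_one] at this
      exact this
    omega
  obtain ⟨x₀, hx₀⟩ := hSne
  have htq := (hTL x₀ hx₀).1
  have h1 : S.card ≤ (q - T.ncard) * Λ.card := by
    refine Finset.card_le_mul_card_image_of_maps_to
      (fun x hx => Finset.mem_image_of_mem _ hx) _ fun L hL => ?_
    obtain ⟨x, hx, rfl⟩ := Finset.mem_image.1 hL
    exact (hTL x hx).2
  set S' := (Set.toFinite {P | P ∈ D ∧ P ≠ Projectivization.mk F e hba0 ∧
    Z ⊔ P.submodule ∈ Λ}).toFinset with hS'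
  have hS'm : ∀ P, P ∈ S' ↔ P ∈ D ∧ P ≠ Projectivization.mk F e hba0 ∧ Z ⊔ P.submodule ∈ Λ :=
    fun P => by rw [hS', Set.Finite.mem_toFinset]; rfl
  have heD : Projectivization.mk F e hba0 ∈ D := ⟨a, ha, b, hb, hba0, rfl⟩
  have h2 : S'.card + 1 ≤ q ^ k - 1 := by
    rw [← hD, ← Set.ncard_sdiff_singleton_add_one heD, ← Set.ncard_coe_finset]
    refine Nat.add_le_add_right (Set.ncard_le_ncard fun P hP => ?_) _
    rw [Finset.mem_coe, hS'm] at hP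
    exact ⟨hP.1, hP.2.1⟩
  have h3 : (q - 2) * Λ.card ≤ S'.card := by
    have hmaps : ∀ P ∈ S', Z ⊔ P.submodule ∈ Λ := fun P hP => ((hS'm P).1 hP).2.2
    refine Finset.mul_card_image_le_card_of_maps_to hmaps _ fun L hL => ?_
    obtain ⟨x, hx, rfl⟩ := Finset.mem_image.1 hL
    rw [hSm] at hx
    obtain ⟨h4, h5⟩ := hplane x hx.1 hx.2
    set L := Submodule.span F {e, x - a} with hLdef
    have heL : e ∈ L := Submodule.subset_span (by simp)
    have h6 : ((D ∩ points L) \ {Projectivization.mk F e hba0}).ncard = q - 2 := by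
      have h7 := Set.ncard_sdiff_singleton_add_one (s := D ∩ points L)
        (a := Projectivization.mk F e hba0) ⟨heD, (mk_mem_points hba0).2 heL⟩
      omega
    rw [← h6, ← Set.ncard_coe_finset]
    refine Set.ncard_le_ncard fun P hP => ?_
    obtain ⟨⟨hPD, hPL⟩, hPe⟩ := hP
    have h7 : Z ⊔ P.submodule = L := by
      induction P using Projectivization.ind with
      | h v hv =>
        rw [mk_mem_points] at hPL
        have h8 : v ∉ Z := fun h => hPe ((mk_eq_mk_iff_mem_span hv hba0).2 h)
        rw [Projectivization.submodule_mk, hZ, ← Submodule.span_union, Set.singleton_union]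
        exact span_pair_eq_of_mem h4 hba0 h8 heL hPL
    rw [Finset.mem_coe, Finset.mem_filter, hS'm]
    exact ⟨⟨hPD, hPe, h7 ▸ hL⟩, h7⟩
  set t := T.ncard
  set m := Λ.card
  obtain ⟨d, hd⟩ : ∃ d, q = t + d := ⟨q - t, by omega⟩
  obtain ⟨s, hs⟩ : ∃ s, t = s + 3 := ⟨t - 3, by omega⟩
  have h4 : (q - 2) * m = d * m + (s + 1) * m := by
    rw [← Nat.add_mul]
    congr 1
    omega
  have h5 : (q - t) * m = d * m := by
    congr 1
    omega
  rw [h5] at h1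
  rw [h4] at h3
  -- at least two planes are needed
  have h6 : 2 ≤ m := by
    by_contra hlt
    have : d * m ≤ d * 1 := Nat.mul_le_mul_left _ (by omega)
    omega
  have h7 : (s + 1) * 2 ≤ (s + 1) * m := Nat.mul_le_mul_left _ h6
  omega

/-- As no three points of `A` are collinear, each of its points is joined to another point of `A`
by exactly one line in each of the `q ^ k - 1` directions. -/
lemma directionGeometry [Finite F] {A : Set W} {k : ℕ} (hq : 16 ≤ Nat.card F)
    (hk : 2 ≤ k) (hW : finrank F W = 2 * k) (hchar : ∀ x : W, x + x = 0)
    (hA : A.ncard = Nat.card F ^ k)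
    (hD : (affineDirections F A).ncard = Nat.card F ^ k - 1)
    (hlines : ∀ L : Submodule F W, finrank F L = 2 →
      (affineDirections F A ∩ points L).ncard = 0 ∨ (affineDirections F A ∩ points L).ncard = 1 ∨
      (affineDirections F A ∩ points L).ncard = 3 ∨
      (affineDirections F A ∩ points L).ncard = Nat.card F - 1) :
    DirectionGeometry F k A ∧ (∀ L : Submodule F W, finrank F L = 2 → ∀ a ∈ A,
      cnt A a L = (affineDirections F A ∩ points L).ncard + 1) ∧
      ∀ a ∈ A, ∀ P ∈ affineDirections F A, ∃ b ∈ A, ∃ h : b - a ≠ 0,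
        P = Projectivization.mk F (b - a) h := by
  have : FiniteDimensional F W := Module.finite_of_finrank_pos (by omega)
  have : Finite W := Module.finite_of_finite F
  have hcol : ∀ a ∈ A, ∀ b ∈ A, ∀ c ∈ A, b ≠ a → c - a ∈ Submodule.span F {b - a} → c = a ∨ c = b :=
    fun a ha b hb c hc hba hcb => eq_or_eq_of_mem_span hq hk hA hD hlines ha hb hc hba hcb
  have hinj : ∀ a ∈ A, ∀ b ∈ A, ∀ c ∈ A, ∀ (hb : b - a ≠ 0) (hc : c - a ≠ 0),
      Projectivization.mk F (b - a) hb = Projectivization.mk F (c - a) hc → b = c := by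
    intro a ha b hb c hc hb0 hc0 h
    rw [mk_eq_mk_iff_mem_span] at h
    rcases hcol a ha c hc b hb (sub_ne_zero.1 hc0) h with h | h
    · exact absurd h (sub_ne_zero.1 hb0)
    · exact h
  have hsurj : ∀ a ∈ A, ∀ P ∈ affineDirections F A, ∃ b ∈ A, ∃ h : b - a ≠ 0,
      P = Projectivization.mk F (b - a) h := by
    intro a ha P hP
    have h1 := Set.surj_on_of_inj_on_of_ncard_le (s := A \ {a}) (t := affineDirections F A)
      (fun b hb => Projectivization.mk F (b - a) (sub_ne_zero.2 hb.2))
      (fun b hb => ⟨a, ha, b, hb.1, sub_ne_zero.2 hb.2, rfl⟩)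
      (fun b c hb hc h => hinj a ha b hb.1 c hc.1 _ _ h)
      (by rw [hD, ← hA, Set.ncard_sdiff_singleton_of_mem ha])
    obtain ⟨b, hb, h⟩ := h1 P hP
    exact ⟨b, hb.1, sub_ne_zero.2 hb.2, h⟩
  have hcnt : ∀ L : Submodule F W, finrank F L = 2 → ∀ a ∈ A,
      cnt A a L = (affineDirections F A ∩ points L).ncard + 1 := by
    intro L hL a ha
    rw [cnt, ← Set.ncard_sdiff_singleton_add_one
      (show a ∈ {x | x ∈ A ∧ x - a ∈ L} from ⟨ha, by simp⟩)]
    congr 1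
    refine Set.ncard_congr (fun b hb => Projectivization.mk F (b - a) (sub_ne_zero.2 hb.2))
      ?_ ?_ ?_
    · intro b hb
      exact ⟨⟨a, ha, b, hb.1.1, sub_ne_zero.2 hb.2, rfl⟩, (mk_mem_points _).2 hb.1.2⟩
    · intro b c hb hc h
      exact hinj a ha b hb.1.1 c hc.1.1 _ _ h
    · rintro P ⟨hPD, hPL⟩
      obtain ⟨b, hb, h, rfl⟩ := hsurj a ha P hPD
      exact ⟨b, ⟨⟨hb, (mk_mem_points h).1 hPL⟩, sub_ne_zero.1 h⟩, rfl⟩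
  refine ⟨⟨hk, hq, hW, hA, hchar, hcol, ?_, ?_, ?_⟩, hcnt, hsurj⟩
  · intro a ha b hb c hc hba
    obtain ⟨d, hd, h, hP⟩ := hsurj c hc (Projectivization.mk F (b - a) (sub_ne_zero.2 hba))
      ⟨a, ha, b, hb, sub_ne_zero.2 hba, rfl⟩
    rw [eq_comm, mk_eq_mk_iff_mem_span] at hP
    exact ⟨d, hd, sub_ne_zero.1 h, hP⟩
  · intro L hL a ha b hb
    rw [hcnt L hL a ha, hcnt L hL b hb]
  · intro L hL a ha
    rw [hcnt L hL a ha]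
    have := hlines L hL
    omega

end

/-! ### The affine chart and the theorem -/

section

variable {F V : Type*} [Field F] [AddCommGroup V] [Module F V]

lemma add_coe_notMem {H : Submodule F V} {v₀ : V} (hv₀ : v₀ ∉ H) (x : H) : v₀ + (x : V) ∉ H :=
  fun h => hv₀ (by simpa using H.sub_mem h x.2)

lemma add_coe_ne_zero {H : Submodule F V} {v₀ : V} (hv₀ : v₀ ∉ H) (x : H) : v₀ + (x : V) ≠ 0 :=
  fun h => add_coe_notMem hv₀ x (h ▸ H.zero_mem)

/-- The affine chart, with origin `⟨v₀⟩`, of the complement of the hyperplane `H`. -/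
def chart {H : Submodule F V} {v₀ : V} (hv₀ : v₀ ∉ H) (x : H) : ℙ F V :=
  Projectivization.mk F (v₀ + x) (add_coe_ne_zero hv₀ x)

lemma chart_injective {H : Submodule F V} {v₀ : V} (hv₀ : v₀ ∉ H) :
    Function.Injective (chart hv₀) := by
  intro x y h
  rw [chart, chart, Projectivization.mk_eq_mk_iff'] at h
  obtain ⟨c, hc⟩ := h
  have h1 : (c - 1) • v₀ = (x : V) - c • (y : V) := by
    rw [sub_smul, one_smul, sub_eq_sub_iff_add_eq_add, ← smul_add, hc, add_comm]
  have h2 : c - 1 = 0 := by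
    by_contra hne
    refine hv₀ ((H.smul_mem_iff hne).1 ?_)
    rw [h1]
    exact H.sub_mem x.2 (H.smul_mem c y.2)
  rw [h2, zero_smul, sub_eq_zero.1 h2, one_smul] at h1
  exact Subtype.ext (sub_eq_zero.1 h1.symm)

lemma mem_range_chart [FiniteDimensional F V] {H : Submodule F V} {v₀ : V} (hv₀ : v₀ ∉ H)
    (hH : finrank F H + 1 = finrank F V) {P : ℙ F V} (hP : P ∉ points H) :
    P ∈ Set.range (chart hv₀) := by
  induction P using Projectivization.ind with
  | h v hv =>
    rw [mk_mem_points] at hP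
    have hv₀0 : v₀ ≠ 0 := fun h => hv₀ (h ▸ H.zero_mem)
    have hdisj : Disjoint H (Submodule.span F {v₀}) :=
      (Submodule.disjoint_span_singleton' hv₀0).2 hv₀
    have htop : H ⊔ Submodule.span F {v₀} = ⊤ := by
      refine Submodule.eq_top_of_finrank_eq ?_
      have h := Submodule.finrank_sup_add_finrank_inf_eq H (Submodule.span F {v₀})
      rw [hdisj.eq_bot, finrank_bot, finrank_span_singleton hv₀0] at h
      omega
    obtain ⟨x, hx, z, hz, rfl⟩ := Submodule.mem_sup.1 (htop ▸ Submodule.mem_top : v ∈ _)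
    obtain ⟨c, rfl⟩ := Submodule.mem_span_singleton.1 hz
    have hc : c ≠ 0 := by
      rintro rfl
      exact hP (by simpa using hx)
    refine ⟨c⁻¹ • ⟨x, hx⟩, ?_⟩
    rw [chart, Projectivization.mk_eq_mk_iff']
    refine ⟨c⁻¹, ?_⟩
    rw [smul_add, smul_smul, inv_mul_cancel₀ hc, one_smul, add_comm]
    rfl

lemma chart_sup_chart_inf {H : Submodule F V} {v₀ : V} (hv₀ : v₀ ∉ H) (x y : H) :
    ((chart hv₀ x).submodule ⊔ (chart hv₀ y).submodule) ⊓ H =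
      (Submodule.span F {y - x}).map H.subtype := by
  rw [chart, chart, Projectivization.submodule_mk, Projectivization.submodule_mk,
    Submodule.map_span, Set.image_singleton]
  apply le_antisymm
  · rintro z ⟨hz, hzH⟩
    obtain ⟨z₁, hz₁, z₂, hz₂, rfl⟩ := Submodule.mem_sup.1 hz
    obtain ⟨c, rfl⟩ := Submodule.mem_span_singleton.1 hz₁
    obtain ⟨d, rfl⟩ := Submodule.mem_span_singleton.1 hz₂
    have h1 : (c + d) • v₀ ∈ H := by
      have h2 := H.sub_mem hzH (H.add_mem (H.smul_mem c x.2) (H.smul_mem d y.2))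
      rw [smul_add, smul_add, add_add_add_comm, add_sub_cancel_right, ← add_smul] at h2
      exact h2
    have h2 : c + d = 0 := by
      by_contra hne
      exact hv₀ ((H.smul_mem_iff hne).1 h1)
    refine Submodule.mem_span_singleton.2 ⟨d, ?_⟩
    rw [eq_neg_of_add_eq_zero_left h2, Submodule.subtype_apply, Submodule.coe_sub]
    module
  · rw [Submodule.span_singleton_le_iff_mem]
    refine ⟨?_, (y - x).2⟩
    have h1 : H.subtype (y - x) = (-1 : F) • (v₀ + (x : V)) + (1 : F) • (v₀ + (y : V)) := by
      rw [Submodule.subtype_apply, Submodule.coe_sub]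
      module
    rw [h1]
    exact Submodule.add_mem_sup (Submodule.smul_mem _ _ (Submodule.mem_span_singleton_self _))
      (Submodule.smul_mem _ _ (Submodule.mem_span_singleton_self _))

/-- In the affine chart, the points `P₁P₂ ∩ H` are the points spanned by differences. -/
lemma directions_eq_affineDirections [FiniteDimensional F V] {H : Submodule F V} {v₀ : V}
    (hv₀ : v₀ ∉ H) (hH : finrank F H + 1 = finrank F V) {Q : Set (ℙ F V)}
    (hQ : ∀ P ∈ Q, P ∉ points H) :
    directions H Q = affineDirections F (chart hv₀ ⁻¹' Q) := by
  have hinj := Submodule.map_injective_of_injective (f := H.subtype) H.injective_subtype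
  ext P
  constructor
  · rintro ⟨P₁, h₁, P₂, h₂, hne, h⟩
    obtain ⟨x, rfl⟩ := mem_range_chart hv₀ hH (hQ P₁ h₁)
    obtain ⟨y, rfl⟩ := mem_range_chart hv₀ hH (hQ P₂ h₂)
    rw [chart_sup_chart_inf] at h
    refine ⟨x, h₁, y, h₂, sub_ne_zero.2 fun h => hne (h ▸ rfl), ?_⟩
    apply Projectivization.submodule_injective
    rw [Projectivization.submodule_mk]
    exact hinj h
  · rintro ⟨x, hx, y, hy, hxy, rfl⟩
    refine ⟨_, hx, _, hy, fun h => hxy (sub_eq_zero.2 (chart_injective hv₀ h).symm), ?_⟩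
    rw [chart_sup_chart_inf, Projectivization.submodule_mk]

end

end PG

open PG Module in
theorem mainTheorem5 {F V : Type*} [Field F] [Finite F] [AddCommGroup V] [Module F V]
    [Algebra (ZMod 2) F] [Module (ZMod 2) V] [IsScalarTower (ZMod 2) F V]
    (q h k : ℕ) (hq : q = 2 ^ h) (hh : 4 ≤ h) (hk : 2 ≤ k) (hF : Nat.card F = q)
    (hV : Module.finrank F V = 2 * k + 1)
    (H : Submodule F V) (hH : Module.finrank F H = 2 * k)
    (Q : Set (ℙ F V)) (hQ_affine : ∀ P ∈ Q, P ∉ PG.points H) (hQ_card : Q.ncard = q ^ k)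
    (D : Set (ℙ F H)) (hD : D = PG.directions H Q) (hD_card : D.ncard = q ^ k - 1)
    (hlines : ∀ L : Submodule F H, Module.finrank F L = 2 →
      (D ∩ PG.points L).ncard = 0 ∨ (D ∩ PG.points L).ncard = 1 ∨
      (D ∩ PG.points L).ncard = 3 ∨ (D ∩ PG.points L).ncard = q - 1) :
    PG.IsPseudoregulus (ZMod 2) k D (PG.secants D (q - 1)) ∧
    (PG.secants D (q - 1)).ncard = (q ^ k - 1) / (q - 1) ∧
    (PG.secants D (q - 1)).PairwiseDisjoint id ∧
    ∃ T₀ T₁ : Submodule F H, Disjoint T₀ T₁ ∧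
      {T | PG.IsTransversal k D (PG.secants D (q - 1)) T} = {T₀, T₁} := by
  have : FiniteDimensional F V := Module.finite_of_finrank_pos (by omega)
  have : Finite V := Module.finite_of_finite F
  have hq16 : 16 ≤ q := by
    rw [hq]
    exact Nat.pow_le_pow_right (n := 2) (by omega) hh
  obtain ⟨v₀, hv₀⟩ : ∃ v₀, v₀ ∉ H := by
    by_contra hno
    push Not at hno
    have h1 : H = ⊤ := Submodule.eq_top_iff'.2 hno
    rw [h1, finrank_top] at hH
    omega
  have hH1 : finrank F H + 1 = finrank F V := by omega
  set A := chart hv₀ ⁻¹' Q with hA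
  have hDA : D = affineDirections F A := by
    rw [hD, directions_eq_affineDirections hv₀ hH1 hQ_affine]
  have hAcard : A.ncard = q ^ k := by
    rw [← hQ_card]
    exact Set.ncard_preimage_of_injective_subset_range (chart_injective hv₀)
      fun P hP => mem_range_chart hv₀ hH1 (hQ_affine P hP)
  have hchar : ∀ x : H, x + x = 0 := fun x => ZModModule.add_self x
  subst hDA
  subst hF
  obtain ⟨G, hcnt, hdir⟩ := directionGeometry hq16 hk hH hchar hAcard hD_card hlines
  obtain ⟨a, ha⟩ : A.Nonempty := by
    apply Set.nonempty_of_ncard_ne_zero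
    rw [hAcard]
    exact pow_ne_zero _ (by omega)
  have S := G.secantGeometry ha
  set U := G.translate ha with hU
  -- the directions are the points of the linear set of `U`
  have hmk : ∀ (v : H) (hv : v ≠ 0), Projectivization.mk F v hv ∈ affineDirections F A ↔
      ∃ c : F, c ≠ 0 ∧ c • v ∈ U := by
    intro v hv
    constructor
    · intro hvD
      obtain ⟨b, hb, hba, h⟩ := hdir a ha _ hvD
      rw [eq_comm, Projectivization.mk_eq_mk_iff'] at h
      obtain ⟨c, hc⟩ := h
      refine ⟨c, ?_, ?_⟩
      · rintro rfl
        exact hba (by rw [← hc, zero_smul])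
      · rw [hc, hU, DirectionGeometry.mem_translate, sub_add_cancel]
        exact hb
    · rintro ⟨c, hc, hcv⟩
      refine ⟨a, ha, c • v + a, hcv, ?_, ?_⟩
      · rw [add_sub_cancel_right]
        exact smul_ne_zero hc hv
      · rw [Projectivization.mk_eq_mk_iff']
        refine ⟨c⁻¹, ?_⟩
        rw [add_sub_cancel_right, smul_smul, inv_mul_cancel₀ hc, one_smul]
  have hsec : secants (affineDirections F A) (Nat.card F - 1) = {L | IsSecant U L} := by
    ext L
    simp only [secants, IsSecant, Set.mem_ofPred_eq, hU, G.card_sect_translate ha]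
    refine and_congr_right fun hL => ?_
    rw [hcnt L hL a ha]
    omega
  have htrans : ∀ T : Submodule F H,
      IsTransversal k (affineDirections F A) {L | IsSecant U L} T ↔
        finrank F T = k ∧ (∀ x ∈ T, x ∈ U → x = 0) ∧
          ∀ M : Submodule F H, IsSecant U M → ∃ x ∈ T, x ∈ M ∧ x ≠ 0 := by
    intro T
    constructor
    · rintro ⟨h1, h2, h3⟩
      refine ⟨h1, fun x hx hxU => ?_, fun M hM => ?_⟩
      · by_contra hx0
        exact Set.disjoint_left.1 h2 ((hmk x hx0).2 ⟨1, one_ne_zero, by simpa using hxU⟩)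
          ((mk_mem_points hx0).2 hx)
      · obtain ⟨P, hPT, hPM⟩ := h3 M hM
        induction P using Projectivization.ind with
        | h v hv => exact ⟨v, (mk_mem_points hv).1 hPT, (mk_mem_points hv).1 hPM, hv⟩
    · rintro ⟨h1, h2, h3⟩
      refine ⟨h1, Set.disjoint_left.2 fun P hPD hPT => ?_, fun M hM => ?_⟩
      · induction P using Projectivization.ind with
        | h v hv =>
          obtain ⟨c, hc, hcv⟩ := (hmk v hv).1 hPD
          exact smul_ne_zero hc hv (h2 _ (T.smul_mem c ((mk_mem_points hv).1 hPT)) hcv)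
      · obtain ⟨x, hxT, hxM, hx0⟩ := h3 M hM
        exact ⟨Projectivization.mk F x hx0, (mk_mem_points hx0).2 hxT, (mk_mem_points hx0).2 hxM⟩
  obtain ⟨L, hL⟩ : ∃ L : Submodule F H, IsSecant U L := by
    have h1 : 1 < Nat.card U := by
      rw [S.card_eq]
      exact Nat.one_lt_pow (by omega) (by omega)
    have : Nontrivial U := (Finite.one_lt_card_iff_nontrivial).1 h1
    obtain ⟨u, hu, hu0⟩ := U.exists_ne_zero_of_nontrivial
    obtain ⟨L, hL, -⟩ := S.exists_secant hu hu0
    exact ⟨L, hL⟩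
  obtain ⟨x, y, hx, hy, hxy⟩ := S.exists_eigenvectors hL
  have hdisj := S.disjoint_transversal hL hx hy hxy
  have hset : {T | IsTransversal k (affineDirections F A) {L | IsSecant U L} T} =
      {S.transversal hL hx, S.transversal hL hy} := by
    ext T
    rw [Set.mem_ofPred_eq, htrans, Set.mem_insert_iff, Set.mem_singleton_iff]
    constructor
    · rintro ⟨h1, h2, h3⟩
      exact S.eq_transversal_or_eq_transversal hL hx hy hxy h1 h2 h3
    · have key : ∀ z : L, ∀ hz : IsEigen U L z, finrank F (S.transversal hL hz) = k ∧
          (∀ x ∈ S.transversal hL hz, x ∈ U → x = 0) ∧ ∀ M : Submodule F H, IsSecant U M →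
            ∃ x ∈ S.transversal hL hz, x ∈ M ∧ x ≠ 0 := fun z hz =>
        ⟨S.finrank_transversal hL hz, fun x hx hxU => S.eq_zero_of_mem_transversal hL hz hx hxU,
          fun M hM => S.exists_mem_transversal hL hz hM⟩
      rintro (rfl | rfl)
      · exact key x hx
      · exact key y hy
  have hpair : {L : Submodule F H | IsSecant U L}.PairwiseDisjoint id :=
    fun L hL M hM hLM => S.disjoint L M hL hM hLM
  have hnc : {L : Submodule F H | IsSecant U L}.ncard =
      (Nat.card F ^ k - 1) / (Nat.card F - 1) :=
    (Nat.div_eq_of_eq_mul_left (by omega) S.card_secants.symm).symm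
  have hdeg : finrank (ZMod 2) F = h := by
    have : Module.Finite (ZMod 2) F := Module.Finite.of_finite
    have h1 := Module.natCard_eq_pow_finrank (K := ZMod 2) (V := F)
    rw [hq, Nat.card_zmod] at h1
    exact (Nat.pow_right_injective le_rfl h1).symm
  have hscat : IsScatteredLinearSet (ZMod 2) (k * finrank (ZMod 2) F) (affineDirections F A) := by
    refine ⟨AddSubgroup.toZModSubmodule 2 U, ?_, ?_, fun P => ?_⟩
    · have h1 := Module.natCard_eq_pow_finrank (K := ZMod 2) (V := AddSubgroup.toZModSubmodule 2 U)
      have h2 : Nat.card (AddSubgroup.toZModSubmodule 2 U) = Nat.card U := rfl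
      rw [h2, S.card_eq, hq, Nat.card_zmod, ← pow_mul] at h1
      rw [hdeg, mul_comm]
      exact (Nat.pow_right_injective le_rfl h1).symm
    · ext P
      constructor
      · intro hP
        obtain ⟨b, hb, hba, rfl⟩ := hdir a ha P hP
        refine ⟨b - a, hba, ?_, rfl⟩
        rw [AddSubgroup.mem_toZModSubmodule, hU, DirectionGeometry.mem_translate, sub_add_cancel]
        exact hb
      · rintro ⟨u, hu0, hu, rfl⟩
        exact (hmk u hu0).2 ⟨1, one_ne_zero, by simpa using hu⟩
    · have h1 := Module.natCard_eq_pow_finrank (K := ZMod 2)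
        (V := ↥(AddSubgroup.toZModSubmodule 2 U ⊓ P.submodule.restrictScalars (ZMod 2)))
      have h2 : Nat.card ↥(AddSubgroup.toZModSubmodule 2 U ⊓
          P.submodule.restrictScalars (ZMod 2)) = Nat.card (sect U P.submodule) := rfl
      have h3 := S.scattered.card_sect_le_two (P := P.submodule) P.finrank_submodule.le
      rw [← h2, h1, Nat.card_zmod] at h3
      exact (Nat.pow_le_pow_iff_right (le_refl 2)).1 (h3.trans_eq (pow_one 2).symm)
  rw [hsec]
  refine ⟨⟨hk, by omega, hH, hscat, fun s hs => hs.1, hnc, hpair, ?_, ?_⟩, hnc, hpair,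
    _, _, hdisj, hset⟩
  · intro s hs
    rw [← hsec] at hs
    rw [hs.2, Nat.card_zmod]
    simp
  · rw [hset, Set.ncard_pair]
    intro h
    have h1 := S.finrank_transversal hL hx
    rw [h] at hdisj
    rw [h, disjoint_self.1 hdisj, finrank_bot] at h1
    omega
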